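/- **Corollary 5.6 (asymptotic Bernstein–von Mises theorem for a discrete probability distribution).** For each $n$ let $d_n\ge 1$ be an integer and let $$\Theta_n=\Big\{\theta\in\mathbb R^{d_n}:\ \theta_j>0\ (1\le j\le d_n),\ \textstyle\sum_{j=1}^{d_n}\theta_j<1\Big\}.$$ For $\theta\in\Theta_n$ put $\theta_0=1-\sum_{j=1}^{d_n}\theta_j$, so that $(\theta_0,\dots,\theta_{d_n})$ is a strictly positive pmf on $d_n+1$ states. Let $\theta^*_n\in\Theta_n$ be ground truth pmfs, let $\theta^*_{\min,n}=\min_{0\le j\le d_n}(\theta^*_n)_j$, and let $N=(N_0,\dots,N_{d_n})\sim\mathrm{Multi}(n,\theta^*_n)$ be the counts of $n$ independent draws from $\theta^*_n$. Let $$L_n(\theta)=\prod_{j=0}^{d_n}\theta_j^{N_j},\qquad \ell_n=-\tfrac1n\log L_n,\qquad \ell^*_n(\theta)=\mathbb E[\ell_n(\theta)],\qquad F^*_n=\nabla^2\ell^*_n(\theta^*_n),$$ where the derivatives are in the free parameters $\theta_1,\dots,\theta_{d_n}$. Let $\rho_n:\mathbb R^{d_n}\to[0,\infty)$ be a measurable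 prior density (not necessarily normalized) with $\rho_n(\theta^*_n)>0$. The posterior $\pi_n$ is the probability measure on $\Theta_n$ with Lebesgue density proportional to $e^{-n\ell_n}\rho_n$. When $\ell_n$ has a unique minimizer $\hat\theta_n$ over $\Theta_n$ (the maximum likelihood estimator), let $\gamma^*_n=\mathcal N(\hat\theta_n,(nF^*_n)^{-1})$. For $s\ge0$ let $U^*_n(s)=\{\theta\in\mathbb R^{d_n}:\ ((\theta-\theta^*_n)^{\top}F^*_n(\theta-\theta^*_n))^{1/2}\le s\sqrt{d_n/n}\}$ and $$\delta^*_{01n}(s)=\sup_{\theta\in U^*_n(s)}\|\nabla\log\rho_n(\theta)\|_{F^*_n},\qquad M^*_{0n}=\frac1{d_n}\log\sup_{\theta\in\Theta_n}\frac{\rho_n(\theta)}{\rho_n(\theta^*_n)},$$ where $\|g\|_{F}=\sup\{g^{\top}u:\ u^{\top}Fu=1\}=|F^{-1/2}g|$, and $\delta^*_{01n}(s)=\infty$ if $\rho_n$ is not $C^1$ (in a neighborhood of each point) or not strictly positive on $U^*_n(s)$. Suppose that, as $n\to\infty$, $$M^*_{0n}=O(1),\qquad \delta^*_{01n}(s)=o(\sqrt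 n)\ \text{ for each } s\ge0,\qquad \frac{d_n^2}{n\,\theta^*_{\min,n}}\to0 .$$ Then $\mathrm{TV}(\pi_n,\gamma^*_n)\to0$ with probability tending to $1$, where $\mathrm{TV}(\mu,\nu)=\sup_A|\mu(A)-\nu(A)|$. That is, for every $\varepsilon>0$, the probability that $\pi_n$ is well defined, that the maximum likelihood estimator exists and is unique, and that $\mathrm{TV}(\pi_n,\gamma^*_n)\le\varepsilon$, tends to $1$ as $n\to\infty$. -/

import Mathlib

open MeasureTheory ProbabilityTheory Filter Topology
open scoped ENNReal Matrix

namespace PmfBvM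

noncomputable section

/-- The parameter space: the probabilities of states `1, …, d` of a strictly positive pmf on
the `d + 1` states `0, 1, …, d`. -/
def Theta (d : ℕ) : Set (EuclideanSpace ℝ (Fin d)) :=
  {θ | (∀ j, 0 < θ j) ∧ ∑ j, θ j < 1}

/-- The full vector `(θ₀, θ₁, …, θ_d)`, where `θ₀ = 1 - ∑ θ_j`. -/
def fullPmf {d : ℕ} (θ : EuclideanSpace ℝ (Fin d)) : Fin (d + 1) → ℝ :=
  Fin.cons (1 - ∑ j, θ j) (fun j => θ j)

/-- The smallest of the `d + 1` probabilities. -/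
def thetaMin {d : ℕ} (θ : EuclideanSpace ℝ (Fin d)) : ℝ :=
  ⨅ j, fullPmf θ j

/-- The law on the `d + 1` states with probabilities `θ₀, …, θ_d`. -/
def categorical {d : ℕ} (θ : EuclideanSpace ℝ (Fin d)) : Measure (Fin (d + 1)) :=
  ∑ j, ENNReal.ofReal (fullPmf θ j) • Measure.dirac j

/-- The counts `(N₀, …, N_d)` of the states in a sample of size `n`. -/
def counts {d n : ℕ} (x : Fin n → Fin (d + 1)) : Fin (d + 1) → ℕ :=
  fun j => (Finset.univ.filter (fun i => x i = j)).card

/-- `Multi(n, θ)`: the law of the counts of `n` independent draws from `θ`. -/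
def multinomial {d : ℕ} (n : ℕ) (θ : EuclideanSpace ℝ (Fin d)) : Measure (Fin (d + 1) → ℕ) :=
  (Measure.pi (fun _ : Fin n => categorical θ)).map counts

/-- The likelihood `L(θ) = ∏ θ_j ^ N_j`. -/
def likelihood {d : ℕ} (N : Fin (d + 1) → ℕ) (θ : EuclideanSpace ℝ (Fin d)) : ℝ :=
  ∏ j, fullPmf θ j ^ N j

/-- The negative normalized log likelihood `ℓ = -(1/n) log L`. -/
def nll {d : ℕ} (n : ℕ) (N : Fin (d + 1) → ℕ) (θ : EuclideanSpace ℝ (Fin d)) : ℝ :=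
  -(1 / (n : ℝ)) * Real.log (likelihood N θ)

/-- The negative population log likelihood `ℓ*(θ) = 𝔼 ℓ(θ)`, for data with law
`Multi(n, θs)`. -/
def popNll {d : ℕ} (n : ℕ) (θs θ : EuclideanSpace ℝ (Fin d)) : ℝ :=
  ∫ N, nll n N θ ∂(multinomial n θs)

/-- The matrix of second partial derivatives of `f` at `x`. -/
def hessian {d : ℕ} (f : EuclideanSpace ℝ (Fin d) → ℝ) (x : EuclideanSpace ℝ (Fin d)) :
    Matrix (Fin d) (Fin d) ℝ :=
  Matrix.of fun i j =>
    iteratedFDeriv ℝ 2 f x ![EuclideanSpace.single i 1, EuclideanSpace.single j 1]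

/-- The Fisher information matrix `F* = ∇²ℓ*(θ*)`. -/
def fisher {d : ℕ} (n : ℕ) (θs : EuclideanSpace ℝ (Fin d)) : Matrix (Fin d) (Fin d) ℝ :=
  hessian (popNll n θs) θs

/-- The weighted norm `|u|_A = |A^{1/2} u| = (uᵀ A u)^{1/2}` of a vector. -/
def wNorm {d : ℕ} (A : Matrix (Fin d) (Fin d) ℝ) (u : EuclideanSpace ℝ (Fin d)) : ℝ :=
  √(u.ofLp ⬝ᵥ (A *ᵥ u.ofLp))

/-- The weighted norm `‖S‖_A = sup {S u : |u|_A = 1}` of a linear form. -/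
def dualNorm {d : ℕ} (A : Matrix (Fin d) (Fin d) ℝ) (S : EuclideanSpace ℝ (Fin d) →L[ℝ] ℝ) :
    ℝ≥0∞ :=
  ⨆ (u : EuclideanSpace ℝ (Fin d)) (_ : wNorm A u = 1), ENNReal.ofReal (S u)

/-- The neighbourhood `U*(s) = {θ : |θ - θ*|_{F*} ≤ s √(d/n)}`, a subset of all of `ℝ^d`. -/
def nbhd {d : ℕ} (n : ℕ) (θs : EuclideanSpace ℝ (Fin d)) (s : ℝ) :
    Set (EuclideanSpace ℝ (Fin d)) :=
  {θ | wNorm (fisher n θs) (θ - θs) ≤ s * √((d : ℝ) / n)}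

open Classical in
/-- `δ*₀₁(s) = sup {‖∇ log ρ(θ)‖_{F*} : θ ∈ U*(s)}`, with value `∞` if the prior `ρ` is not
`C¹` or not strictly positive on `U*(s)`. -/
def delta01 {d : ℕ} (n : ℕ) (ρ : EuclideanSpace ℝ (Fin d) → ℝ) (θs : EuclideanSpace ℝ (Fin d))
    (s : ℝ) : ℝ≥0∞ :=
  if ∀ θ ∈ nbhd n θs s, ContDiffAt ℝ 1 ρ θ ∧ 0 < ρ θ then
    ⨆ θ ∈ nbhd n θs s, dualNorm (fisher n θs) (fderiv ℝ (fun η => Real.log (ρ η)) θ)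
  else ⊤

/-- `M₀* = d⁻¹ log sup {ρ(θ) / ρ(θ*) : θ ∈ Θ}`, with value `∞` if `ρ` is unbounded on `Θ`. It is
used only when `ρ(θ*) > 0`. -/
def M0 {d : ℕ} (ρ : EuclideanSpace ℝ (Fin d) → ℝ) (θs : EuclideanSpace ℝ (Fin d)) : EReal :=
  (((d : ℝ)⁻¹ : ℝ) : EReal) * ENNReal.log (⨆ θ ∈ Theta d, ENNReal.ofReal (ρ θ / ρ θs))

/-- The measure on `Θ` with Lebesgue density `e^{-nℓ} ρ`. -/
def unnormPosterior {d : ℕ} (n : ℕ) (ρ : EuclideanSpace ℝ (Fin d) → ℝ) (N : Fin (d + 1) → ℕ) :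
    Measure (EuclideanSpace ℝ (Fin d)) :=
  (volume.restrict (Theta d)).withDensity
    (fun θ => ENNReal.ofReal (Real.exp (-(n * nll n N θ)) * ρ θ))

/-- The posterior `π ∝ e^{-nℓ} ρ` on `Θ`. It is a probability measure exactly if the
normalizing constant is neither `0` nor `∞`. -/
def posterior {d : ℕ} (n : ℕ) (ρ : EuclideanSpace ℝ (Fin d) → ℝ) (N : Fin (d + 1) → ℕ) :
    Measure (EuclideanSpace ℝ (Fin d)) :=
  (unnormPosterior n ρ N Set.univ)⁻¹ • unnormPosterior n ρ N

/-- `θh` is the unique minimizer of `ℓ` over `Θ`: the maximum likelihood estimator exists, is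
unique, and equals `θh`. -/
def IsUniqueMLE {d : ℕ} (n : ℕ) (N : Fin (d + 1) → ℕ) (θh : EuclideanSpace ℝ (Fin d)) : Prop :=
  θh ∈ Theta d ∧ ∀ θ ∈ Theta d, θ ≠ θh → nll n N θh < nll n N θ

/-- The Gaussian `γ* = 𝒩(θh, (n F*)⁻¹)`. -/
def gammaStar {d : ℕ} (n : ℕ) (θs θh : EuclideanSpace ℝ (Fin d)) :
    Measure (EuclideanSpace ℝ (Fin d)) :=
  multivariateGaussian θh ((n : ℝ) • fisher n θs)⁻¹

/-- The total variation distance `sup_A |μ(A) - ν(A)|` of two probability measures. -/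
def tvDist {E : Type*} [MeasurableSpace E] (μ ν : Measure E) : ℝ :=
  ⨆ A : {A : Set E // MeasurableSet A}, |μ.real A.1 - ν.real A.1|

end

end PmfBvM

/-!
Write `|u|` for the norm given by `F*`; then `|x - y|² = ∑ j, (x_j - y_j)² / θ*_j` over all
`d + 1` states. The maximum likelihood estimator `θh` is the vector of empirical frequencies, and
Chebyshev's inequality gives `|θh - θ*| ≤ K √(d/n)` with probability at least `1 - 1/K²`.

On `U = U*(s)`, the log posterior density and the quadratic `-n |x - θh|² / 2` differ by a function
whose increments are at most `η √n |x - y|`: the Taylor remainder of the log likelihood contributes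
`4 s² d / √(n θ*_min)` to `η`, and the prior contributes `δ*₀₁(s) / √n`. By the parallelogram
identity, the densities `w` of the posterior and `g` of `γ*` then satisfy
`w(x) g(y)² / w(y) ≤ exp (η²) g((x + y) / 2)²` on `U`. Prékopa–Leindler applied to `w` and `g² / w`
turns this pointwise bound into `π(U) ∫_U g² / w ≤ exp (η²)`, so the chi-square divergence of `γ*`
from `π` over `U`, and hence the total variation distance, is small in any dimension.

Outside `U`, a log-concave density falls off so fast that shrinking by `1/2` towards its mode gains
a factor `exp (s² d / 64)`, while volumes change by only `2 ^ d`; this controls the tails of both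
measures, up to the factor `exp ((C + 1) d)` by which the prior can vary.
-/

namespace PmfBvM

section PrekopaLeindler

/-- With `u = max K` and `v = min L`, the midpoints of `K` with `v` and of `u` with `L` lie in `C`
and have at most one point in common. -/
lemma brunn_minkowski_real_of_isCompact {K L C : Set ℝ} (hK : IsCompact K) (hL : IsCompact L)
    (hKn : K.Nonempty) (hLn : L.Nonempty) (hC : ∀ x ∈ K, ∀ y ∈ L, midpoint ℝ x y ∈ C) :
    volume K + volume L ≤ 2 * volume C := by
  obtain ⟨u, huK, hu⟩ := hK.exists_isGreatest hKn
  obtain ⟨v, hvL, hv⟩ := hL.exists_isLeast hLn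
  have hvol (c : ℝ) (S : Set ℝ) :
      volume (AffineMap.homothety c (2⁻¹ : ℝ) '' S) = 2⁻¹ * volume S := by
    simp [Measure.addHaar_image_homothety]
  have hKC : AffineMap.homothety v (2⁻¹ : ℝ) '' K ⊆ C := by
    rintro _ ⟨x, hx, rfl⟩
    rw [homothety_inv_two, midpoint_comm]
    exact hC x hx v hvL
  have hLC : AffineMap.homothety u (2⁻¹ : ℝ) '' L ⊆ C := by
    rintro _ ⟨y, hy, rfl⟩
    rw [homothety_inv_two]
    exact hC u huK y hy
  have hdisj : AEDisjoint volume (AffineMap.homothety v (2⁻¹ : ℝ) '' K)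
      (AffineMap.homothety u (2⁻¹ : ℝ) '' L) := by
    refine measure_mono_null ?_ (Real.volume_singleton (a := midpoint ℝ u v))
    rintro _ ⟨⟨x, hx, rfl⟩, ⟨y, hy, hxy⟩⟩
    have hxu := hu hx
    have hvy := hv hy
    simp only [homothety_inv_two, midpoint_eq_smul_add, smul_eq_mul, invOf_eq_inv,
      Set.mem_singleton_iff] at hxy ⊢
    linarith
  have hmeas : MeasurableSet (AffineMap.homothety u (2⁻¹ : ℝ) '' L) :=
    (hL.image (AffineMap.homothety_continuous u _)).isClosed.measurableSet
  have hle := measure_mono (μ := volume) (Set.union_subset hKC hLC)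
  rw [measure_union₀ hmeas.nullMeasurableSet hdisj, hvol, hvol, ← mul_add] at hle
  simpa [← mul_assoc, ENNReal.mul_inv_cancel] using mul_le_mul_right hle 2

lemma brunn_minkowski_real {A B C : Set ℝ} (hA : MeasurableSet A) (hB : MeasurableSet B)
    (hAn : A.Nonempty) (hBn : B.Nonempty) (hC : ∀ x ∈ A, ∀ y ∈ B, midpoint ℝ x y ∈ C) :
    volume A + volume B ≤ 2 * volume C := by
  obtain ⟨a, ha⟩ := hAn
  obtain ⟨b, hb⟩ := hBn
  rw [hA.measure_eq_iSup_isCompact, hB.measure_eq_iSup_isCompact]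
  simp only [iSup_and']
  refine ENNReal.biSup_add_biSup_le' ⟨∅, by simp, isCompact_empty⟩ ⟨∅, by simp, isCompact_empty⟩ ?_
  rintro K ⟨hKA, hK⟩ L ⟨hLB, hL⟩
  calc volume K + volume L ≤ volume (insert a K) + volume (insert b L) := by
        gcongr <;> exact Set.subset_insert _ _
    _ ≤ 2 * volume C := brunn_minkowski_real_of_isCompact (hK.insert a) (hL.insert b)
        (Set.insert_nonempty a K) (Set.insert_nonempty b L) fun x hx y hy =>
          hC x (Set.insert_subset ha hKA hx) y (Set.insert_subset hb hLB hy)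

lemma lintegral_eq_lintegral_meas_ofReal_lt {α : Type*} [MeasurableSpace α] (μ : Measure α)
    {f : α → ℝ≥0∞} (hf : Measurable f) (hfin : ∀ x, f x ≠ ⊤) :
    ∫⁻ x, f x ∂μ = ∫⁻ t in Set.Ioi 0, μ {x | ENNReal.ofReal t < f x} := by
  have hlayer := lintegral_eq_lintegral_meas_lt μ (.of_forall fun x => (f x).toReal_nonneg)
    hf.ennreal_toReal.aemeasurable
  simp only [ENNReal.ofReal_toReal (hfin _)] at hlayer
  rw [hlayer]
  refine setLIntegral_congr_fun measurableSet_Ioi fun t ht => ?_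
  simp only [ENNReal.ofReal_lt_iff_lt_toReal (Set.mem_Ioi.1 ht).le (hfin _)]

/-- Brunn–Minkowski applied to the superlevel sets. The normalization ensures that those of `a`
and of `b` become empty at the same level. -/
lemma lintegral_add_le_two_mul_of_iSup_eq_one {a b f : ℝ → ℝ≥0∞} (ha : Measurable a)
    (hb : Measurable b) (hf : Measurable f) (ha1 : ⨆ x, a x = 1) (hb1 : ⨆ x, b x = 1)
    (h : ∀ x y, a x * b y ≤ f (midpoint ℝ x y) ^ 2) :
    (∫⁻ x, a x) + ∫⁻ x, b x ≤ 2 * ∫⁻ x, f x := by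
  have hale x : a x ≤ 1 := ha1 ▸ le_iSup a x
  have hble x : b x ≤ 1 := hb1 ▸ le_iSup b x
  suffices (∫⁻ x, a x) + ∫⁻ x, b x ≤ 2 * ∫⁻ x, min (f x) 1 from
    this.trans (by gcongr; exact min_le_left _ _)
  have hmin x y : a x * b y ≤ min (f (midpoint ℝ x y)) 1 ^ 2 := by
    rcases le_total (f (midpoint ℝ x y)) 1 with h1 | h1
    · simpa [h1] using h x y
    · simpa [h1] using mul_le_one' (hale x) (hble y)
  rw [lintegral_eq_lintegral_meas_ofReal_lt _ ha fun x => ne_top_of_le_ne_top (by simp) (hale x),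
    lintegral_eq_lintegral_meas_ofReal_lt _ hb fun x => ne_top_of_le_ne_top (by simp) (hble x),
    lintegral_eq_lintegral_meas_ofReal_lt _ (hf.min measurable_const) fun x => by simp,
    ← lintegral_const_mul' _ _ (by simp), ← lintegral_add_left]
  · refine setLIntegral_mono' measurableSet_Ioi fun t _ => ?_
    rcases lt_or_ge (ENNReal.ofReal t) 1 with h1 | h1
    · refine brunn_minkowski_real (ha measurableSet_Ioi) (hb measurableSet_Ioi)
        (lt_iSup_iff (f := a).1 (ha1 ▸ h1)) (lt_iSup_iff (f := b).1 (hb1 ▸ h1)) fun x hx y hy => ?_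
      have hsq : ENNReal.ofReal t ^ 2 < min (f (midpoint ℝ x y)) 1 ^ 2 :=
        (sq (ENNReal.ofReal t) ▸ ENNReal.mul_lt_mul hx hy).trans_le (hmin x y)
      exact lt_of_not_ge fun hge : min _ _ ≤ _ => hsq.not_ge (by gcongr)
    · simp [((hale _).trans h1).not_gt, ((hble _).trans h1).not_gt]
  · refine Antitone.measurable fun s t hst => measure_mono fun x hx => ?_
    exact (ENNReal.ofReal_le_ofReal hst).trans_lt hx

lemma four_mul_mul_le_sq_add (a b : ℝ≥0∞) : 4 * (a * b) ≤ (a + b) ^ 2 := by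
  wlog hab : a ≤ b generalizing a b
  · simpa only [mul_comm, add_comm] using this b a (le_of_not_ge hab)
  obtain ⟨c, rfl⟩ := exists_add_of_le hab
  calc 4 * (a * (a + c)) ≤ 4 * (a * (a + c)) + c ^ 2 := le_self_add
    _ = (a + (a + c)) ^ 2 := by ring

lemma prekopa_leindler_real_of_iSup_ne_top {a b f : ℝ → ℝ≥0∞} (ha : Measurable a)
    (hb : Measurable b) (hf : Measurable f) (hat : ⨆ x, a x ≠ ⊤) (hbt : ⨆ x, b x ≠ ⊤)
    (h : ∀ x y, a x * b y ≤ f (midpoint ℝ x y) ^ 2) :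
    (∫⁻ x, a x) * ∫⁻ x, b x ≤ (∫⁻ x, f x) ^ 2 := by
  by_cases ha0 : ⨆ x, a x = 0
  · simp_all
  by_cases hb0 : ⨆ x, b x = 0
  · simp_all
  obtain ⟨α, hα⟩ : ∃ α, α = ⨆ x, a x := ⟨_, rfl⟩
  obtain ⟨β, hβ⟩ : ∃ β, β = ⨆ x, b x := ⟨_, rfl⟩
  rw [← hα] at ha0 hat
  rw [← hβ] at hb0 hbt
  obtain ⟨r, hr⟩ : ∃ r : ℝ≥0∞, r ^ 2 = α * β :=
    ⟨(α * β) ^ ((2 : ℕ)⁻¹ : ℝ), ENNReal.rpow_inv_natCast_pow two_ne_zero _⟩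
  have hnorm := lintegral_add_le_two_mul_of_iSup_eq_one (a := fun x => a x / α)
    (b := fun x => b x / β) (f := fun x => f x / r) (by fun_prop) (by fun_prop) (by fun_prop)
    (by rw [← ENNReal.iSup_div, ← hα, ENNReal.div_self ha0 hat])
    (by rw [← ENNReal.iSup_div, ← hβ, ENNReal.div_self hb0 hbt]) fun x y => by
      simp only [div_eq_mul_inv, mul_pow, ← ENNReal.inv_pow, hr,
        ENNReal.mul_inv (.inl ha0) (.inl hat)]
      calc a x * α⁻¹ * (b y * β⁻¹) = a x * b y * (α⁻¹ * β⁻¹) := by ring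
        _ ≤ _ := by gcongr; exact h x y
  simp only [div_eq_mul_inv, lintegral_mul_const _ ha, lintegral_mul_const _ hb,
    lintegral_mul_const _ hf] at hnorm
  have hprod : 4 * ((∫⁻ x, a x) * α⁻¹ * ((∫⁻ x, b x) * β⁻¹)) ≤ 4 * ((∫⁻ x, f x) * r⁻¹) ^ 2 :=
    calc _ ≤ _ := four_mul_mul_le_sq_add _ _
      _ ≤ (2 * ((∫⁻ x, f x) * r⁻¹)) ^ 2 := by gcongr
      _ = _ := by ring
  rw [ENNReal.mul_le_mul_iff_right (by simp) (by simp), mul_pow, ← ENNReal.inv_pow, hr,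
    ENNReal.mul_inv (.inl ha0) (.inl hat), mul_mul_mul_comm] at hprod
  have hαβ : α⁻¹ * β⁻¹ ≠ 0 := by simp [hat, hbt]
  exact (ENNReal.mul_le_mul_iff_left hαβ (by simp [ha0, hb0, ENNReal.mul_eq_top])).1 hprod

lemma lintegral_eq_iSup_lintegral_min {α : Type*} [MeasurableSpace α] {μ : Measure α}
    {f : α → ℝ≥0∞} (hf : Measurable f) : ∫⁻ x, f x ∂μ = ⨆ n : ℕ, ∫⁻ x, min (f x) n ∂μ := by
  rw [← lintegral_iSup (fun n => by fun_prop) (fun m n hmn x => by dsimp only; gcongr)]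
  refine lintegral_congr fun x => ?_
  rw [← inf_iSup_eq, ENNReal.iSup_natCast, inf_top_eq]

lemma prekopa_leindler_real {a b f : ℝ → ℝ≥0∞} (ha : Measurable a)
    (hb : Measurable b) (hf : Measurable f) (h : ∀ x y, a x * b y ≤ f (midpoint ℝ x y) ^ 2) :
    (∫⁻ x, a x) * ∫⁻ x, b x ≤ (∫⁻ x, f x) ^ 2 := by
  have hsup (u : ℝ → ℝ≥0∞) (n : ℕ) : ⨆ x, min (u x) (n : ℝ≥0∞) ≠ ⊤ :=
    ne_top_of_le_ne_top (ENNReal.natCast_ne_top n) (iSup_le fun x => min_le_right _ _)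
  rw [lintegral_eq_iSup_lintegral_min ha, lintegral_eq_iSup_lintegral_min hb]
  simp_rw [ENNReal.iSup_mul, ENNReal.mul_iSup]
  refine iSup_le fun m => iSup_le fun n => ?_
  exact prekopa_leindler_real_of_iSup_ne_top (by fun_prop) (by fun_prop) hf (hsup _ _)
    (hsup _ _) fun x y => (mul_le_mul' (min_le_left _ _) (min_le_left _ _)).trans (h x y)

lemma measurable_comp_finCons {n : ℕ} {f : (Fin (n + 1) → ℝ) → ℝ≥0∞} (hf : Measurable f) :
    Measurable fun p : ℝ × (Fin n → ℝ) => f (Fin.cons p.1 p.2) := by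
  refine hf.comp (measurable_pi_lambda _ fun i => ?_)
  refine Fin.cases ?_ (fun j => ?_) i
  · exact measurable_fst
  · exact (measurable_pi_apply j).comp measurable_snd

lemma lintegral_eq_lintegral_finCons {n : ℕ} {f : (Fin (n + 1) → ℝ) → ℝ≥0∞} (hf : Measurable f) :
    ∫⁻ x, f x = ∫⁻ s : ℝ, ∫⁻ z : Fin n → ℝ, f (Fin.cons s z) := by
  have hm := (volume_preserving_piFinSuccAbove (fun _ : Fin (n + 1) => ℝ) 0).symm
  rw [← hm.lintegral_comp hf, Measure.volume_eq_prod,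
    lintegral_prod]
  · simp [MeasurableEquiv.piFinSuccAbove, Fin.insertNthEquiv]
  · exact (hf.comp hm.measurable).aemeasurable

lemma prekopa_leindler_pi {n : ℕ} {a b f : (Fin n → ℝ) → ℝ≥0∞} (ha : Measurable a)
    (hb : Measurable b) (hf : Measurable f) (h : ∀ x y, a x * b y ≤ f (midpoint ℝ x y) ^ 2) :
    (∫⁻ x, a x) * ∫⁻ x, b x ≤ (∫⁻ x, f x) ^ 2 := by
  induction n with
  | zero =>
    have heval (u : (Fin 0 → ℝ) → ℝ≥0∞) : ∫⁻ x, u x = u default := by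
      rw [volume_pi, Measure.pi_of_empty _ default, lintegral_dirac]
    rw [heval, heval, heval]
    convert h default default
  | succ n ih =>
    rw [lintegral_eq_lintegral_finCons ha, lintegral_eq_lintegral_finCons hb,
      lintegral_eq_lintegral_finCons hf]
    refine prekopa_leindler_real (measurable_comp_finCons ha).lintegral_prod_right'
      (measurable_comp_finCons hb).lintegral_prod_right'
      (measurable_comp_finCons hf).lintegral_prod_right' fun s t => ?_
    refine ih ((measurable_comp_finCons ha).comp measurable_prodMk_left)
      ((measurable_comp_finCons hb).comp measurable_prodMk_left)
      ((measurable_comp_finCons hf).comp measurable_prodMk_left) fun x y => ?_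
    convert h (Fin.cons s x) (Fin.cons t y) using 3
    ext i
    refine Fin.cases ?_ (fun j => ?_) i <;> simp [midpoint_eq_smul_add, mul_add]

variable {E : Type*} [NormedAddCommGroup E] [InnerProductSpace ℝ E] [FiniteDimensional ℝ E]
  [MeasurableSpace E] [BorelSpace E]

theorem prekopa_leindler {a b f : E → ℝ≥0∞} (ha : Measurable a) (hb : Measurable b)
    (hf : Measurable f) (h : ∀ x y, a x * b y ≤ f (midpoint ℝ x y) ^ 2) :
    (∫⁻ x, a x) * ∫⁻ x, b x ≤ (∫⁻ x, f x) ^ 2 := by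
  let e := (stdOrthonormalBasis ℝ E).repr.symm.toLinearEquiv.toLinearMap ∘ₗ
    (WithLp.linearEquiv 2 ℝ (Fin (Module.finrank ℝ E) → ℝ)).symm.toLinearMap
  have he : MeasurePreserving e :=
    (stdOrthonormalBasis ℝ E).measurePreserving_repr_symm.comp (PiLp.volume_preserving_toLp _)
  rw [← he.lintegral_comp ha, ← he.lintegral_comp hb, ← he.lintegral_comp hf]
  refine prekopa_leindler_pi (ha.comp he.measurable) (hb.comp he.measurable)
    (hf.comp he.measurable) fun x y => ?_
  rw [show e (midpoint ℝ x y) = midpoint ℝ (e x) (e y) by simp [midpoint_eq_smul_add]]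
  exact h _ _

end PrekopaLeindler

section GaussianDensity

variable {ι : Type*} [Fintype ι]

lemma pi_gaussianReal_eq_withDensity : Measure.pi (fun _ : ι => gaussianReal 0 1) =
    volume.withDensity fun x => ENNReal.ofReal (∏ i, gaussianPDFReal 0 1 (x i)) := by
  refine Measure.pi_eq fun s hs => ?_
  have hint (i : ι) : IntegrableOn (gaussianPDFReal 0 1) (s i) :=
    (integrable_gaussianPDFReal 0 1).integrableOn
  rw [withDensity_apply _ (MeasurableSet.univ_pi hs), volume_pi, Measure.restrict_pi_pi,
    ← ofReal_integral_eq_lintegral_ofReal (Integrable.fintype_prod hint)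
      (.of_forall fun x => Finset.prod_nonneg fun i _ => gaussianPDFReal_nonneg _ _ _),
    integral_fintype_prod_eq_prod, ENNReal.ofReal_prod_of_nonneg
      fun i _ => integral_nonneg fun x => gaussianPDFReal_nonneg _ _ _]
  simp only [gaussianReal_apply_eq_integral _ one_ne_zero]

lemma map_withDensity_comp {α β : Type*} [MeasurableSpace α] [MeasurableSpace β] {μ : Measure α}
    {T : α → β} (hT : Measurable T) {f : β → ℝ≥0∞} (hf : Measurable f) :
    (μ.withDensity (f ∘ T)).map T = (μ.map T).withDensity f := by
  ext s hs
  rw [Measure.map_apply hT hs, withDensity_apply _ (hT hs), withDensity_apply _ hs,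
    setLIntegral_map hs hf hT]
  rfl

lemma exists_stdGaussian_eq_withDensity : ∃ k : ℝ, 0 < k ∧ stdGaussian (EuclideanSpace ℝ ι) =
    volume.withDensity fun x => ENNReal.ofReal (k * Real.exp (-(x.ofLp ⬝ᵥ x.ofLp) / 2)) := by
  refine ⟨(√(2 * Real.pi))⁻¹ ^ Fintype.card ι, by positivity, ?_⟩
  have hm := PiLp.volume_preserving_toLp ι
  rw [← map_pi_eq_stdGaussian, pi_gaussianReal_eq_withDensity]
  conv_rhs => rw [← hm.map_eq, ← map_withDensity_comp hm.measurable (by fun_prop)]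
  congr 2
  funext x
  simp only [Function.comp, gaussianPDFReal, Finset.prod_mul_distrib, Finset.prod_const,
    Finset.card_univ, ← Real.exp_sum]
  simp [dotProduct, ← Finset.sum_div, pow_two]

variable [DecidableEq ι]

lemma exists_map_add_toEuclideanCLM_volume {R : Matrix ι ι ℝ} (hR : IsUnit R)
    (m : EuclideanSpace ℝ ι) : ∃ c : ℝ, 0 < c ∧
      volume.map (fun x => m + Matrix.toEuclideanCLM (𝕜 := ℝ) R x) = ENNReal.ofReal c • volume := by
  let B : EuclideanSpace ℝ ι →ₗ[ℝ] EuclideanSpace ℝ ι := Matrix.toEuclideanCLM (𝕜 := ℝ) R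
  have hdet : LinearMap.det B ≠ 0 := (((hR.map (Matrix.toEuclideanCLM (𝕜 := ℝ))).map
    ContinuousLinearMap.toLinearMapRingHom).map LinearMap.det).ne_zero
  refine ⟨|(LinearMap.det B)⁻¹|, by positivity, ?_⟩
  have hB : Measurable B := (Matrix.toEuclideanCLM (𝕜 := ℝ) R).measurable
  calc volume.map (fun x => m + B x) = (volume.map B).map (m + ·) :=
        (Measure.map_map (by fun_prop) hB).symm
    _ = _ := by
      rw [Measure.map_linearMap_addHaar_eq_smul_addHaar _ hdet, Measure.map_smul,
        map_add_left_eq_self]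

open scoped MatrixOrder in
lemma sqrt_inv_mul_mul_sqrt_inv {A : Matrix ι ι ℝ} (hA : A.PosDef) :
    CFC.sqrt A⁻¹ * A * CFC.sqrt A⁻¹ = 1 := by
  refine mul_eq_one_comm.1 ?_
  rw [← mul_assoc, CFC.sqrt_mul_sqrt_self _ hA.inv.posSemidef.nonneg,
    Matrix.nonsing_inv_mul _ ((Matrix.isUnit_iff_isUnit_det A).1 hA.isUnit)]

open scoped MatrixOrder in
lemma dotProduct_mulVec_sqrt_inv_mulVec {A : Matrix ι ι ℝ} (hA : A.PosDef) (x : ι → ℝ) :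
    (CFC.sqrt A⁻¹ *ᵥ x) ⬝ᵥ (A *ᵥ (CFC.sqrt A⁻¹ *ᵥ x)) = x ⬝ᵥ x := by
  have hsymm : (CFC.sqrt A⁻¹)ᵀ = CFC.sqrt A⁻¹ := by
    simpa [IsSelfAdjoint, Matrix.star_eq_conjTranspose]
      using (CFC.sqrt_nonneg A⁻¹).isSelfAdjoint
  rw [Matrix.mulVec_mulVec, Matrix.dotProduct_mulVec, ← Matrix.vecMul_transpose, hsymm,
    Matrix.vecMul_vecMul, ← mul_assoc, sqrt_inv_mul_mul_sqrt_inv hA, Matrix.vecMul_one]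

lemma withDensity_smul_measure_ofReal {α : Type*} [MeasurableSpace α] {μ : Measure α} {c : ℝ}
    (hc : 0 ≤ c) {f : α → ℝ} (hf : Measurable f) :
    (ENNReal.ofReal c • μ).withDensity (fun x => ENNReal.ofReal (f x)) =
      μ.withDensity fun x => ENNReal.ofReal (c * f x) := by
  rw [withDensity_smul_measure, ← withDensity_smul _ (by fun_prop)]
  congr 1
  funext x
  simp [ENNReal.ofReal_mul hc]

open scoped MatrixOrder in
lemma exists_multivariateGaussian_inv_eq_withDensity {A : Matrix ι ι ℝ} (hA : A.PosDef)
    (m : EuclideanSpace ℝ ι) : ∃ k : ℝ, 0 < k ∧ multivariateGaussian m A⁻¹ =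
      volume.withDensity fun x =>
        ENNReal.ofReal (k * Real.exp (-((x - m).ofLp ⬝ᵥ (A *ᵥ (x - m).ofLp)) / 2)) := by
  obtain ⟨k, hk, hstd⟩ := exists_stdGaussian_eq_withDensity (ι := ι)
  obtain ⟨c, hc, hmap⟩ := exists_map_add_toEuclideanCLM_volume
    (IsUnit.of_mul_eq_one_right _ (sqrt_inv_mul_mul_sqrt_inv hA)) m
  let q (x : EuclideanSpace ℝ ι) : ℝ :=
    k * Real.exp (-((x - m).ofLp ⬝ᵥ (A *ᵥ (x - m).ofLp)) / 2)
  have hq : Measurable q := by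
    simp only [q, dotProduct, Matrix.mulVec]
    fun_prop
  have hpull (x : EuclideanSpace ℝ ι) : k * Real.exp (-(x.ofLp ⬝ᵥ x.ofLp) / 2) =
      q (m + Matrix.toEuclideanCLM (𝕜 := ℝ) (CFC.sqrt A⁻¹) x) := by
    simp only [q, add_sub_cancel_left, Matrix.ofLp_toEuclideanCLM,
      dotProduct_mulVec_sqrt_inv_mulVec hA]
  refine ⟨c * k, by positivity, ?_⟩
  simp only [multivariateGaussian, hstd, hpull]
  refine (map_withDensity_comp (f := fun x => ENNReal.ofReal (q x))
    (by fun_prop) (by fun_prop)).trans ?_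
  simp only [hmap, withDensity_smul_measure_ofReal hc.le hq, q, mul_assoc]

end GaussianDensity

section HalvingTail

variable {E : Type*} [NormedAddCommGroup E] [NormedSpace ℝ E] [FiniteDimensional ℝ E]
  [MeasurableSpace E] [BorelSpace E] (μ : Measure E) [μ.IsAddHaarMeasure]

lemma lintegral_comp_midpoint {f : E → ℝ≥0∞} (hf : Measurable f) (c : E) :
    ∫⁻ x, f (midpoint ℝ c x) ∂μ = 2 ^ Module.finrank ℝ E * ∫⁻ x, f x ∂μ := by
  have hshift : Measurable fun x => f ((2⁻¹ : ℝ) • c + x) := by fun_prop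
  simp_rw [midpoint_eq_smul_add, invOf_eq_inv, smul_add]
  rw [← lintegral_map hshift (measurable_const_smul (2⁻¹ : ℝ)),
    Measure.map_addHaar_smul _ (by norm_num), lintegral_smul_measure, lintegral_add_left_eq_self]
  simp [abs_of_pos, ENNReal.ofReal_pow]

/-- A log-concave `f` with mode `c` satisfies `hmid` for `m = f c`. -/
lemma setLIntegral_le_of_le_sq_midpoint {f : E → ℝ} (hf : Measurable f) (hf0 : ∀ x, 0 ≤ f x)
    {c : E} {m r : ℝ} (hr : 0 ≤ r) (hmid : ∀ x, f x * m ≤ f (midpoint ℝ c x) ^ 2) {W : Set E}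
    (hW : MeasurableSet W) (hWle : ∀ x ∈ W, f x ≤ r ^ 2 * m) :
    ∫⁻ x in W, ENNReal.ofReal (f x) ∂μ ≤
      ENNReal.ofReal r * 2 ^ Module.finrank ℝ E * ∫⁻ x, ENNReal.ofReal (f x) ∂μ := by
  have hhalf (x : E) (hx : x ∈ W) : f x ≤ r * f (midpoint ℝ c x) := by
    refine le_of_sq_le_sq ?_ (mul_nonneg hr (hf0 _))
    calc f x ^ 2 ≤ (r ^ 2 * m) * f x := by
          rw [sq]
          exact mul_le_mul_of_nonneg_right (hWle x hx) (hf0 x)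
      _ = r ^ 2 * (f x * m) := by ring
      _ ≤ r ^ 2 * f (midpoint ℝ c x) ^ 2 := by gcongr; exact hmid x
      _ = (r * f (midpoint ℝ c x)) ^ 2 := by ring
  calc ∫⁻ x in W, ENNReal.ofReal (f x) ∂μ
      ≤ ∫⁻ x in W, ENNReal.ofReal r * ENNReal.ofReal (f (midpoint ℝ c x)) ∂μ :=
        setLIntegral_mono' hW fun x hx => by
          rw [← ENNReal.ofReal_mul hr]
          exact ENNReal.ofReal_le_ofReal (hhalf x hx)
    _ ≤ ∫⁻ x, ENNReal.ofReal r * ENNReal.ofReal (f (midpoint ℝ c x)) ∂μ :=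
        setLIntegral_le_lintegral _ _
    _ = _ := by
      rw [lintegral_const_mul' _ _ ENNReal.ofReal_ne_top,
        lintegral_comp_midpoint μ hf.ennreal_ofReal, mul_assoc]

end HalvingTail

section TotalVariation

variable {α : Type*} [MeasurableSpace α] {μ π γ : Measure α} {w g : α → ℝ} {U : Set α} {κ : ℝ}

lemma measureReal_withDensity_ofReal (hw : Integrable w μ) (hw0 : ∀ x, 0 ≤ w x) {S : Set α}
    (hS : MeasurableSet S) :
    (μ.withDensity fun x => ENNReal.ofReal (w x)).real S = ∫ x in S, w x ∂μ := by
  rw [measureReal_def, withDensity_apply _ hS,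
    ← ofReal_integral_eq_lintegral_ofReal hw.integrableOn (.of_forall hw0),
    ENNReal.toReal_ofReal (integral_nonneg hw0)]

lemma integrable_of_withDensity_isFiniteMeasure (hw : Measurable w) (hw0 : ∀ x, 0 ≤ w x)
    [IsFiniteMeasure (μ.withDensity fun x => ENNReal.ofReal (w x))] : Integrable w μ := by
  refine ⟨hw.aestronglyMeasurable, ?_⟩
  rw [hasFiniteIntegral_iff_ofReal (.of_forall hw0), ← setLIntegral_univ,
    ← withDensity_apply _ .univ]
  exact measure_lt_top _ _

lemma tvDist_le_setIntegral_abs_sub_add [IsFiniteMeasure π] [IsFiniteMeasure γ]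
    (hw : Measurable w) (hw0 : ∀ x, 0 ≤ w x) (hg : Measurable g) (hg0 : ∀ x, 0 ≤ g x)
    (hπ : π = μ.withDensity fun x => ENNReal.ofReal (w x))
    (hγ : γ = μ.withDensity fun x => ENNReal.ofReal (g x)) (hU : MeasurableSet U)
    (hπU : π.real Uᶜ ≤ κ) (hγU : γ.real Uᶜ ≤ κ) :
    tvDist π γ ≤ ∫ x in U, |w x - g x| ∂μ + κ := by
  refine ciSup_le fun ⟨A, hA⟩ => ?_
  have hin : |π.real (A ∩ U) - γ.real (A ∩ U)| ≤ ∫ x in U, |w x - g x| ∂μ := by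
    subst hπ hγ
    have hwi := integrable_of_withDensity_isFiniteMeasure (μ := μ) hw hw0
    have hgi := integrable_of_withDensity_isFiniteMeasure (μ := μ) hg hg0
    rw [measureReal_withDensity_ofReal hwi hw0 (hA.inter hU),
      measureReal_withDensity_ofReal hgi hg0 (hA.inter hU),
      ← integral_sub hwi.integrableOn hgi.integrableOn]
    exact abs_integral_le_integral_abs.trans (setIntegral_mono_set
      (hwi.sub hgi).abs.integrableOn (.of_forall fun x => abs_nonneg _)
      Set.inter_subset_right.eventuallyLE)
  have hout : |π.real (A \ U) - γ.real (A \ U)| ≤ κ :=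
    abs_sub_le_of_nonneg_of_le measureReal_nonneg
      ((measureReal_mono fun x hx => hx.2).trans hπU) measureReal_nonneg
      ((measureReal_mono fun x hx => hx.2).trans hγU)
  calc |π.real A - γ.real A|
      = |(π.real (A ∩ U) - γ.real (A ∩ U)) + (π.real (A \ U) - γ.real (A \ U))| := by
        rw [← measureReal_inter_add_sdiff hU, ← measureReal_inter_add_sdiff (μ := γ) hU]
        ring_nf
    _ ≤ |π.real (A ∩ U) - γ.real (A ∩ U)| + |π.real (A \ U) - γ.real (A \ U)| := abs_add_le _ _
    _ ≤ _ := add_le_add hin hout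

/-- The right-hand side is the chi-square divergence `∫ (w - g) ^ 2 / w`. -/
lemma sq_integral_abs_sub_le (hw : Integrable w μ) (hg : Integrable g μ)
    (hgw : Integrable (fun x => g x ^ 2 / w x) μ) (hw0 : ∀ᵐ x ∂μ, 0 < w x)
    (hw1 : ∫ x, w x ∂μ ≤ 1) :
    (∫ x, |w x - g x| ∂μ) ^ 2 ≤ ∫ x, w x ∂μ - 2 * ∫ x, g x ∂μ + ∫ x, g x ^ 2 / w x ∂μ := by
  set L := ∫ x, |w x - g x| ∂μ
  have hpt : ∀ᵐ x ∂μ,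
      2 * L * |w x - g x| - L ^ 2 * w x ≤ w x - 2 * g x + g x ^ 2 / w x := by
    filter_upwards [hw0] with x hx
    have hsq : w x - 2 * g x + g x ^ 2 / w x - (2 * L * |w x - g x| - L ^ 2 * w x) =
        (|w x - g x| - L * w x) ^ 2 / w x := by
      rw [sub_sq, sq_abs]
      field_simp
      ring
    have : 0 ≤ (|w x - g x| - L * w x) ^ 2 / w x := by positivity
    linarith
  have habs : Integrable (fun x => 2 * L * |w x - g x|) μ := (hw.sub hg).abs.const_mul _
  have hsub : Integrable (fun x => w x - 2 * g x) μ := hw.sub (hg.const_mul 2)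
  have hint := integral_mono_ae (habs.sub (hw.const_mul (L ^ 2))) (hsub.add hgw) hpt
  rw [integral_sub' habs (hw.const_mul (L ^ 2)), integral_add' hsub hgw,
    integral_sub hw (hg.const_mul 2), integral_const_mul, integral_const_mul,
    integral_const_mul] at hint
  nlinarith [mul_le_mul_of_nonneg_left hw1 (sq_nonneg L)]

end TotalVariation

section Midpoint

variable {E : Type*} [NormedAddCommGroup E] [InnerProductSpace ℝ E] [FiniteDimensional ℝ E]
  [MeasurableSpace E] [BorelSpace E] {w g : E → ℝ} {U : Set E} {c κ : ℝ}

lemma setLIntegral_mul_setLIntegral_sq_div_le (hw : Measurable w) (hg : Measurable g)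
    (hg0 : ∀ x, 0 ≤ g x) (hU : MeasurableSet U) (hwU : ∀ x ∈ U, 0 < w x) (hc : 0 ≤ c)
    (h : ∀ x ∈ U, ∀ y ∈ U, w x * g y ^ 2 ≤ c * w y * g (midpoint ℝ x y) ^ 2) :
    (∫⁻ x in U, ENNReal.ofReal (w x)) * ∫⁻ x in U, ENNReal.ofReal (g x ^ 2 / w x) ≤
      ENNReal.ofReal c * (∫⁻ x, ENNReal.ofReal (g x)) ^ 2 := by
  have hgw : Measurable fun x => g x ^ 2 / w x := by fun_prop
  have hpt (x y : E) : U.indicator (fun x => ENNReal.ofReal (w x)) x *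
      U.indicator (fun x => ENNReal.ofReal (g x ^ 2 / w x)) y ≤
        (ENNReal.ofReal √c * ENNReal.ofReal (g (midpoint ℝ x y))) ^ 2 := by
    by_cases hx : x ∈ U
    swap
    · simp [hx]
    by_cases hy : y ∈ U
    swap
    · simp [hy]
    rw [Set.indicator_of_mem hx, Set.indicator_of_mem hy, ← ENNReal.ofReal_mul (hwU x hx).le,
      ← ENNReal.ofReal_mul (Real.sqrt_nonneg c), ← ENNReal.ofReal_pow
        (mul_nonneg (Real.sqrt_nonneg c) (hg0 _)), mul_pow, Real.sq_sqrt hc, ← mul_div_assoc]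
    refine ENNReal.ofReal_le_ofReal ((div_le_iff₀ (hwU y hy)).2 ?_)
    linarith [h x hx y hy]
  have hPL := prekopa_leindler (hw.ennreal_ofReal.indicator hU) (hgw.ennreal_ofReal.indicator hU)
    (hg.ennreal_ofReal.const_mul _) hpt
  rwa [lintegral_indicator hU, lintegral_indicator hU,
    lintegral_const_mul' _ _ ENNReal.ofReal_ne_top, mul_pow,
    ← ENNReal.ofReal_pow (Real.sqrt_nonneg c), Real.sq_sqrt hc] at hPL

variable {π γ : Measure E} [IsProbabilityMeasure π] [IsProbabilityMeasure γ]

lemma setLIntegral_sq_div_le (hw : Measurable w) (hg : Measurable g) (hg0 : ∀ x, 0 ≤ g x)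
    (hπ : π = volume.withDensity fun x => ENNReal.ofReal (w x))
    (hγ : γ = volume.withDensity fun x => ENNReal.ofReal (g x)) (hU : MeasurableSet U)
    (hwU : ∀ x ∈ U, 0 < w x) (hc : 0 ≤ c)
    (h : ∀ x ∈ U, ∀ y ∈ U, w x * g y ^ 2 ≤ c * w y * g (midpoint ℝ x y) ^ 2)
    (hκ1 : κ < 1) (hπU : π.real Uᶜ ≤ κ) :
    ∫⁻ x in U, ENNReal.ofReal (g x ^ 2 / w x) ≤ ENNReal.ofReal (c / (1 - κ)) := by
  have hmass : ENNReal.ofReal (1 - κ) ≤ ∫⁻ x in U, ENNReal.ofReal (w x) := by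
    rw [← withDensity_apply _ hU, ← hπ, ← ofReal_measureReal]
    rw [probReal_compl_eq_one_sub hU] at hπU
    exact ENNReal.ofReal_le_ofReal (by linarith)
  have hone : ∫⁻ x, ENNReal.ofReal (g x) = 1 := by
    rw [← setLIntegral_univ, ← withDensity_apply _ .univ, ← hγ, measure_univ]
  have hPL := setLIntegral_mul_setLIntegral_sq_div_le hw hg hg0 hU hwU hc h
  rw [hone, one_pow, mul_one] at hPL
  rw [ENNReal.ofReal_div_of_pos (by linarith),
    ENNReal.le_div_iff_mul_le (.inl (by simpa)) (.inl ENNReal.ofReal_ne_top), mul_comm]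
  exact (mul_le_mul_left hmass _).trans hPL

lemma tvDist_le_sqrt_add (hw : Measurable w) (hw0 : ∀ x, 0 ≤ w x) (hg : Measurable g)
    (hg0 : ∀ x, 0 ≤ g x) (hπ : π = volume.withDensity fun x => ENNReal.ofReal (w x))
    (hγ : γ = volume.withDensity fun x => ENNReal.ofReal (g x)) (hU : MeasurableSet U)
    (hwU : ∀ x ∈ U, 0 < w x) (hc : 0 ≤ c)
    (h : ∀ x ∈ U, ∀ y ∈ U, w x * g y ^ 2 ≤ c * w y * g (midpoint ℝ x y) ^ 2)
    (hκ1 : κ < 1) (hπU : π.real Uᶜ ≤ κ) (hγU : γ.real Uᶜ ≤ κ) :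
    tvDist π γ ≤ √(c / (1 - κ) - 1 + 2 * κ) + κ := by
  have hchi := setLIntegral_sq_div_le hw hg hg0 hπ hγ hU hwU hc h hκ1 hπU
  have hwγ := probReal_compl_eq_one_sub (μ := γ) hU
  refine (tvDist_le_setIntegral_abs_sub_add hw hw0 hg hg0 hπ hγ hU hπU hγU).trans ?_
  subst hπ hγ
  have hwi := integrable_of_withDensity_isFiniteMeasure (μ := volume) hw hw0
  have hgi := integrable_of_withDensity_isFiniteMeasure (μ := volume) hg hg0
  have hwU1 := measureReal_withDensity_ofReal hwi hw0 hU
  rw [measureReal_withDensity_ofReal hgi hg0 hU] at hwγ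
  have hgw : Measurable fun x => g x ^ 2 / w x := by fun_prop
  have hgw0 (x : E) : 0 ≤ g x ^ 2 / w x := div_nonneg (sq_nonneg _) (hw0 x)
  have hgwi : IntegrableOn (fun x => g x ^ 2 / w x) U := by
    refine ⟨hgw.aestronglyMeasurable, ?_⟩
    rw [hasFiniteIntegral_iff_ofReal (.of_forall hgw0)]
    exact hchi.trans_lt ENNReal.ofReal_lt_top
  have hgw_le : ∫ x in U, g x ^ 2 / w x ≤ c / (1 - κ) := by
    rw [integral_eq_lintegral_of_nonneg_ae (.of_forall hgw0) hgw.aestronglyMeasurable]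
    exact ENNReal.toReal_le_of_le_ofReal (div_nonneg hc (by linarith)) hchi
  have hw1 : ∫ x in U, w x ≤ 1 := hwU1 ▸ measureReal_le_one
  gcongr
  refine Real.le_sqrt_of_sq_le ((sq_integral_abs_sub_le hwi.integrableOn hgi.integrableOn hgwi
    (ae_restrict_of_forall_mem hU hwU) hw1).trans ?_)
  linarith

end Midpoint

section ChiSq

variable {ι : Type*} [Fintype ι] {p u v x y h : ι → ℝ} {m r : ℝ}

/-- The weighted sum of squares `∑ u_j² / p_j`. At `u = x - p` it is the chi-square divergence of
the pmf `x` from the pmf `p`, and it is the quadratic form of the Fisher information at `p`. -/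
noncomputable def chiSq (p u : ι → ℝ) : ℝ :=
  ∑ j, u j ^ 2 / p j

lemma chiSq_nonneg (hp : ∀ j, 0 ≤ p j) (u : ι → ℝ) : 0 ≤ chiSq p u :=
  Finset.sum_nonneg fun j _ => div_nonneg (sq_nonneg _) (hp j)

lemma chiSq_pos (hp : ∀ j, 0 < p j) (hu : u ≠ 0) : 0 < chiSq p u := by
  obtain ⟨j, hj⟩ := Function.ne_iff.1 hu
  exact Finset.sum_pos' (fun i _ => div_nonneg (sq_nonneg _) (hp i).le)
    ⟨j, Finset.mem_univ j, div_pos (sq_pos_of_ne_zero hj) (hp j)⟩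

lemma chiSq_smul (p u : ι → ℝ) (c : ℝ) : chiSq p (c • u) = c ^ 2 * chiSq p u := by
  simp only [chiSq, Pi.smul_apply, smul_eq_mul, mul_pow, mul_div_assoc, Finset.mul_sum]

lemma chiSq_sub_comm (p u v : ι → ℝ) : chiSq p (u - v) = chiSq p (v - u) := by
  simp only [chiSq, Pi.sub_apply, sub_sq_comm]

lemma chiSq_parallelogram (p u v : ι → ℝ) :
    chiSq p (u + v) + chiSq p (u - v) = 2 * (chiSq p u + chiSq p v) := by
  simp only [chiSq, ← Finset.sum_add_distrib, Finset.mul_sum]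
  exact Finset.sum_congr rfl fun j _ => by simp only [Pi.add_apply, Pi.sub_apply]; ring

lemma chiSq_sub_le (hp : ∀ j, 0 ≤ p j) (u v : ι → ℝ) :
    chiSq p (u - v) ≤ 2 * (chiSq p u + chiSq p v) :=
  (le_add_of_nonneg_left (chiSq_nonneg hp (u + v))).trans_eq (chiSq_parallelogram p u v)

lemma chiSq_sub_midpoint (p x y z : ι → ℝ) :
    chiSq p (midpoint ℝ x y - z)
      = (chiSq p (x - z) + chiSq p (y - z)) / 2 - chiSq p (x - y) / 4 := by
  have hmid : midpoint ℝ x y - z = (1 / 2 : ℝ) • ((x - z) + (y - z)) := by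
    rw [midpoint_eq_smul_add, invOf_eq_inv]; module
  have h := chiSq_parallelogram p (x - z) (y - z)
  rw [sub_sub_sub_cancel_right] at h
  rw [hmid, chiSq_smul]
  linarith

lemma continuous_chiSq (p : ι → ℝ) : Continuous (chiSq p) := by
  unfold chiSq; fun_prop

lemma convexOn_chiSq (hp : ∀ j, 0 ≤ p j) : ConvexOn ℝ Set.univ (chiSq p) := by
  refine ⟨convex_univ, fun u _ v _ a b ha hb hab => ?_⟩
  simp only [chiSq, smul_eq_mul, Finset.mul_sum, ← Finset.sum_add_distrib]
  refine Finset.sum_le_sum fun j _ => ?_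
  rw [← mul_div_assoc, ← mul_div_assoc, ← add_div]
  exact div_le_div_of_nonneg_right
    ((even_two.convexOn_pow (𝕜 := ℝ)).2 trivial trivial ha hb hab) (hp j)

lemma convex_setOf_chiSq_sub_le (hp : ∀ j, 0 ≤ p j) (z : ι → ℝ) (r : ℝ) :
    Convex ℝ {x | chiSq p (x - z) ≤ r} := by
  simpa [sub_eq_add_neg] using
    ((convexOn_chiSq hp).translate_left (-z)).convex_le r

lemma abs_le_of_chiSq_le (hm : 0 < m) (hp : ∀ j, m ≤ p j) (hu : chiSq p u ≤ r) (j : ι) :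
    |u j| ≤ p j * √(r / m) := by
  have hpj : 0 < p j := hm.trans_le (hp j)
  have hle : u j ^ 2 / p j ≤ r := (Finset.single_le_sum (f := fun j => u j ^ 2 / p j)
    (fun i _ => div_nonneg (sq_nonneg _) (hm.le.trans (hp i))) (Finset.mem_univ j)).trans hu
  have hr : 0 ≤ r := le_trans (by positivity) hle
  refine abs_le_of_sq_le_sq ?_ (by positivity)
  rw [mul_pow, Real.sq_sqrt (by positivity)]
  calc u j ^ 2 ≤ r * p j := (div_le_iff₀ hpj).1 hle
    _ = r * p j * m / m := by field_simp
    _ ≤ r * p j * p j / m := by gcongr; exact hp j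
    _ = p j ^ 2 * (r / m) := by ring

lemma abs_le_div_five_of_chiSq_le (hm : 0 < m) (hp : ∀ j, m ≤ p j) (hr : r ≤ m / 25)
    (hu : chiSq p u ≤ r) (j : ι) : |u j| ≤ p j / 5 := by
  have hpj : 0 < p j := hm.trans_le (hp j)
  refine (abs_le_of_chiSq_le hm hp hu j).trans ?_
  have hsq : √(r / m) ≤ 1 / 5 := by
    rw [Real.sqrt_le_left (by norm_num), div_le_iff₀ hm]
    linarith
  calc p j * √(r / m) ≤ p j * (1 / 5) := by gcongr
    _ = p j / 5 := by ring

lemma mem_Icc_of_chiSq_sub_le (hm : 0 < m) (hp : ∀ j, m ≤ p j) (hr : r ≤ m / 25)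
    (hx : chiSq p (x - p) ≤ r) (j : ι) : x j ∈ Set.Icc (p j / 2) (2 * p j) := by
  have hpj : 0 < p j := hm.trans_le (hp j)
  have h := abs_le.1 (abs_le_div_five_of_chiSq_le hm hp hr hx j)
  simp only [Pi.sub_apply] at h
  constructor <;> linarith

lemma sum_abs_mul_abs_div_le (hp : ∀ j, 0 < p j) (u v : ι → ℝ) :
    ∑ j, |u j| * |v j| / p j ≤ √(chiSq p u) * √(chiSq p v) := by
  have h := Real.sum_mul_le_sqrt_mul_sqrt Finset.univ (fun j => |u j| / √(p j))
    (fun j => |v j| / √(p j))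
  simp only [div_pow, sq_abs, Real.sq_sqrt (hp _).le] at h
  rw [chiSq, chiSq]
  convert h using 2 with j
  rw [div_mul_div_comm, Real.mul_self_sqrt (hp j).le]

end ChiSq

section LogLik

variable {ι : Type*} [Fintype ι] {p x y z h : ι → ℝ} {m r : ℝ}

/-- The log likelihood per observation of the pmf `x`, for data with empirical frequencies `h`. -/
noncomputable def logLik (h x : ι → ℝ) : ℝ :=
  ∑ j, h j * Real.log (x j)

lemma mul_log_lt_mul_log_self_add_sub {a b : ℝ} (ha : 0 < a) (hb : 0 < b) (hne : b ≠ a) :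
    a * Real.log b < a * Real.log a + (b - a) := by
  have hlog := mul_lt_mul_of_pos_left (Real.log_lt_sub_one_of_pos (div_pos hb ha)
    fun h => hne ((div_eq_one_iff_eq ha.ne').1 h)) ha
  rw [Real.log_div hb.ne' ha.ne', mul_sub, mul_sub, mul_div_cancel₀ _ ha.ne'] at hlog
  linarith

lemma logLik_lt_logLik_self (hh : ∀ j, 0 < h j) (hx : ∀ j, 0 < x j) (hsum : ∑ j, x j = ∑ j, h j)
    (hne : x ≠ h) : logLik h x < logLik h h := by
  obtain ⟨i, hi⟩ := Function.ne_iff.1 hne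
  calc logLik h x < ∑ j, (h j * Real.log (h j) + (x j - h j)) := by
        refine Finset.sum_lt_sum (fun j _ => ?_)
          ⟨i, Finset.mem_univ i, mul_log_lt_mul_log_self_add_sub (hh i) (hx i) hi⟩
        rcases eq_or_ne (x j) (h j) with hj | hj
        · rw [hj, sub_self, add_zero]
        · exact (mul_log_lt_mul_log_self_add_sub (hh j) (hx j) hj).le
    _ = logLik h h := by
        rw [Finset.sum_add_distrib, Finset.sum_sub_distrib, hsum, sub_self, add_zero, logLik]

lemma hasDerivAt_logLik_add_chiSq_lineMap (hp : ∀ j, p j ≠ 0) (hsum : ∑ j, x j = ∑ j, y j)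
    {t : ℝ} (hz : ∀ j, AffineMap.lineMap y x t j ≠ 0) :
    HasDerivAt (fun s => logLik h (AffineMap.lineMap y x s)
        + chiSq p (AffineMap.lineMap y x s - h) / 2)
      (∑ j, (x j - y j) * (AffineMap.lineMap y x t j - h j) * (AffineMap.lineMap y x t j - p j)
        / (p j * AffineMap.lineMap y x t j)) t := by
  have hline : ∀ j, HasDerivAt (fun s : ℝ => AffineMap.lineMap y x s j) (x j - y j) t :=
    hasDerivAt_pi.1 AffineMap.hasDerivAt_lineMap
  have hlog : HasDerivAt (fun s => logLik h (AffineMap.lineMap y x s))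
      (∑ j, h j * ((x j - y j) / AffineMap.lineMap y x t j)) t :=
    HasDerivAt.fun_sum fun j _ => ((hline j).log (hz j)).const_mul _
  have hchi : HasDerivAt (fun s => chiSq p (AffineMap.lineMap y x s - h))
      (∑ j, 2 * (AffineMap.lineMap y x t j - h j) * (x j - y j) / p j) t :=
    HasDerivAt.fun_sum fun j _ => by
      simpa using (((hline j).sub_const (h j)).fun_pow 2).div_const (p j)
  refine (hlog.add (hchi.div_const 2)).congr_deriv ?_
  have hsum0 : ∑ j, (x j - y j) = 0 := by rw [Finset.sum_sub_distrib, hsum, sub_self]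
  rw [← sub_zero (_ + _), ← hsum0, Finset.sum_div, ← Finset.sum_add_distrib,
    ← Finset.sum_sub_distrib]
  refine Finset.sum_congr rfl fun j _ => ?_
  have := hp j
  have := hz j
  field_simp
  ring

lemma sum_mul_mul_div_le (hm : 0 < m) (hp : ∀ j, m ≤ p j) (u : ι → ℝ)
    (hz : ∀ j, p j / 2 ≤ z j) (hzr : chiSq p (z - p) ≤ r) (hh : chiSq p (h - p) ≤ r) :
    ∑ j, u j * (z j - h j) * (z j - p j) / (p j * z j) ≤ 4 * r / √m * √(chiSq p u) := by
  have hp0 : ∀ j, 0 < p j := fun j => hm.trans_le (hp j)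
  have hr0 : 0 ≤ r := (chiSq_nonneg (fun j => (hp0 j).le) _).trans hh
  set Q := chiSq p u
  have hQ0 : 0 ≤ Q := chiSq_nonneg (fun j => (hp0 j).le) u
  have hterm : ∀ j, u j * (z j - h j) * (z j - p j) / (p j * z j)
      ≤ 2 * √(Q / m) * (|(z - h) j| * |(z - p) j| / p j) := fun j => by
    have hpj := hp0 j
    have hzj : 0 < z j := (half_pos hpj).trans_le (hz j)
    refine (le_abs_self _).trans ?_
    rw [abs_div, abs_mul, abs_mul, abs_of_pos (mul_pos hpj hzj), div_le_iff₀ (by positivity)]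
    calc |u j| * |z j - h j| * |z j - p j|
        ≤ (p j * √(Q / m)) * |z j - h j| * |z j - p j| := by
          gcongr; exact abs_le_of_chiSq_le hm hp le_rfl j
      _ = 2 * √(Q / m) * (|(z - h) j| * |(z - p) j| / p j) * (p j * (p j / 2)) := by
          simp only [Pi.sub_apply]; field_simp
      _ ≤ _ := by gcongr; exact hz j
  have hzh : chiSq p (z - h) ≤ 2 ^ 2 * r := by
    have h1 := chiSq_sub_le (fun j => (hp0 j).le) (z - p) (h - p)
    rw [sub_sub_sub_cancel_right] at h1
    linarith
  calc ∑ j, u j * (z j - h j) * (z j - p j) / (p j * z j)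
      ≤ 2 * √(Q / m) * ∑ j, |(z - h) j| * |(z - p) j| / p j := by
        rw [Finset.mul_sum]; exact Finset.sum_le_sum fun j _ => hterm j
    _ ≤ 2 * √(Q / m) * (√(2 ^ 2 * r) * √r) := by
        gcongr; exact (sum_abs_mul_abs_div_le hp0 _ _).trans (by gcongr)
    _ = 4 * r / √m * √Q := by
        rw [Real.sqrt_mul (by norm_num), Real.sqrt_sq (by norm_num), mul_assoc 2 √r,
          Real.mul_self_sqrt hr0, Real.sqrt_div hQ0]
        ring

/-- The left side is a difference of remainders in the second-order expansion of `logLik h` at `h`,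
with the Hessian taken at `p`. -/
lemma logLik_add_chiSq_sub_le (hm : 0 < m) (hp : ∀ j, m ≤ p j) (hr : r ≤ m / 25)
    (hsum : ∑ j, x j = ∑ j, y j) (hx : chiSq p (x - p) ≤ r) (hy : chiSq p (y - p) ≤ r)
    (hh : chiSq p (h - p) ≤ r) :
    (logLik h x + chiSq p (x - h) / 2) - (logLik h y + chiSq p (y - h) / 2)
      ≤ 4 * r / √m * √(chiSq p (x - y)) := by
  have hp0 : ∀ j, 0 < p j := fun j => hm.trans_le (hp j)
  have hzr : ∀ t ∈ Set.Icc (0 : ℝ) 1, chiSq p (AffineMap.lineMap y x t - p) ≤ r := fun t ht =>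
    (convex_setOf_chiSq_sub_le (fun j => (hp0 j).le) p r).lineMap_mem hy hx ht
  have hzp : ∀ t ∈ Set.Icc (0 : ℝ) 1, ∀ j, p j / 2 ≤ AffineMap.lineMap y x t j := fun t ht j =>
    (mem_Icc_of_chiSq_sub_le hm hp hr (hzr t ht) j).1
  have hderiv := fun t (ht : t ∈ Set.Icc (0 : ℝ) 1) =>
    hasDerivAt_logLik_add_chiSq_lineMap (h := h) (fun j => (hp0 j).ne') hsum
      (fun j => ((half_pos (hp0 j)).trans_le (hzp t ht j)).ne')
  obtain ⟨t, ht, hslope⟩ := exists_hasDerivAt_eq_slope _ _ zero_lt_one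
    (fun t ht => (hderiv t ht).continuousAt.continuousWithinAt)
    (fun t ht => hderiv t (Set.Ioo_subset_Icc_self ht))
  rw [AffineMap.lineMap_apply_zero, AffineMap.lineMap_apply_one, sub_zero, div_one] at hslope
  rw [← hslope]
  have ht' := Set.Ioo_subset_Icc_self ht
  exact sum_mul_mul_div_le hm hp (x - y) (hzp t ht') (hzr t ht') hh

lemma log_one_add_le_sub_sq {v : ℝ} (hv : |v| ≤ 1 / 5) : Real.log (1 + v) ≤ v - v ^ 2 / 4 := by
  have htaylor := Real.abs_log_sub_add_sum_range_le (x := -v) (by rw [abs_neg]; linarith) 2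
  simp only [Finset.sum_range_succ, Finset.sum_range_zero, abs_neg, sub_neg_eq_add] at htaylor
  have hrem : |v| ^ (2 + 1) / (1 - |v|) ≤ v ^ 2 / 4 := by
    rw [div_le_iff₀ (by linarith), ← sq_abs v]
    nlinarith [sq_nonneg |v|, abs_nonneg v]
  have hle := (abs_le.1 (htaylor.trans hrem)).2
  norm_num at hle
  linarith

lemma logLik_add_le (hh : ∀ j, 0 < h j) {u : ι → ℝ} (hu : ∀ j, |u j| ≤ h j / 5)
    (hsum : ∑ j, u j = 0) : logLik h (h + u) ≤ logLik h h - chiSq h u / 4 := by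
  have hlog : ∀ j, h j * Real.log ((h + u) j)
      ≤ h j * Real.log (h j) + (u j - u j ^ 2 / h j / 4) := fun j => by
    have hv : |u j / h j| ≤ 1 / 5 := by
      rw [abs_div, abs_of_pos (hh j), div_le_iff₀ (hh j)]
      linarith [hu j]
    have hv0 : 1 + u j / h j ≠ 0 := by linarith [(abs_le.1 hv).1]
    have hmul := mul_le_mul_of_nonneg_left (log_one_add_le_sub_sq hv) (hh j).le
    have hhj := (hh j).ne'
    rw [Pi.add_apply, show h j + u j = h j * (1 + u j / h j) by field_simp,
      Real.log_mul hhj hv0, mul_add]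
    refine (add_le_add_iff_left _).2 (hmul.trans_eq ?_)
    field_simp
  calc logLik h (h + u) ≤ ∑ j, (h j * Real.log (h j) + (u j - u j ^ 2 / h j / 4)) :=
        Finset.sum_le_sum fun j _ => hlog j
    _ = logLik h h - chiSq h u / 4 := by
        rw [Finset.sum_add_distrib, Finset.sum_sub_distrib, hsum, ← Finset.sum_div, logLik, chiSq]
        ring

lemma mul_logLik_sub_logLik_le (hh : ∀ j, 0 < h j) (hx : ∀ j, 0 < x j) {t : ℝ}
    (ht : t ∈ Set.Icc (0 : ℝ) 1) :
    t * (logLik h x - logLik h h) ≤ logLik h (h + t • (x - h)) - logLik h h := by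
  simp only [logLik, ← Finset.sum_sub_distrib, Finset.mul_sum]
  refine Finset.sum_le_sum fun j _ => ?_
  have hconc := strictConcaveOn_log_Ioi.concaveOn.2 (hx j) (hh j) ht.1
    (sub_nonneg.2 ht.2) (by ring)
  have hseg : t • x j + (1 - t) • h j = (h + t • (x - h)) j := by
    simp only [smul_eq_mul, Pi.add_apply, Pi.smul_apply, Pi.sub_apply]; ring
  rw [hseg] at hconc
  simp only [smul_eq_mul] at hconc
  nlinarith [mul_le_mul_of_nonneg_left hconc (hh j).le]

lemma logLik_le_sub_of_le_chiSq (hm : 0 < m) (hp : ∀ j, m ≤ p j) (hr : r ≤ m / 25) (hr0 : 0 < r)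
    (hsum : ∑ j, x j = ∑ j, h j) (hx : ∀ j, 0 < x j) (hh : chiSq p (h - p) ≤ r)
    (hxh : r / 4 ≤ chiSq p (x - h)) : logLik h x ≤ logLik h h - r / 32 := by
  have hp0 : ∀ j, 0 < p j := fun j => hm.trans_le (hp j)
  have hhp := mem_Icc_of_chiSq_sub_le hm hp hr hh
  have hh0 : ∀ j, 0 < h j := fun j => (half_pos (hp0 j)).trans_le (hhp j).1
  set Q := chiSq p (x - h)
  have hQ0 : 0 < Q := by linarith
  -- Move `x` towards `h` until `chiSq p (x - h) = r / 4`; by concavity this can only help.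
  set t := √(r / 4 / Q)
  have ht0 : 0 < t := by positivity
  have ht1 : t ≤ 1 := Real.sqrt_le_one.2 ((div_le_one hQ0).2 hxh)
  set u := t • (x - h) with hu
  have huQ : chiSq p u = r / 4 := by
    rw [chiSq_smul, Real.sq_sqrt (by positivity), div_mul_cancel₀ _ hQ0.ne']
  have hu_le : ∀ j, |u j| ≤ h j / 5 := fun j => by
    have h2u : chiSq p ((2 : ℝ) • u) ≤ r := by rw [chiSq_smul, huQ]; linarith
    have habs := abs_le_div_five_of_chiSq_le hm hp hr h2u j
    rw [Pi.smul_apply, smul_eq_mul, abs_mul, abs_two] at habs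
    linarith [(hhp j).1]
  have hu_sum : ∑ j, u j = 0 := by
    simp [hu, ← Finset.mul_sum, hsum]
  have hchi : r / 4 ≤ 2 * chiSq h u := by
    rw [← huQ, chiSq, chiSq, Finset.mul_sum]
    refine Finset.sum_le_sum fun j _ => ?_
    have := hp0 j
    have := hh0 j
    rw [← mul_div_assoc, div_le_div_iff₀ (by positivity) (by positivity)]
    nlinarith [(hhp j).2, sq_nonneg (u j)]
  have hgain := (mul_logLik_sub_logLik_le hh0 hx ⟨ht0.le, ht1⟩).trans
    (sub_le_sub_right (logLik_add_le hh0 hu_le hu_sum) _)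
  nlinarith

end LogLik

section Simplex

variable {d : ℕ} {θ : EuclideanSpace ℝ (Fin d)}

/-- The linear part `u ↦ (-∑ u_j, u₁, …, u_d)` of the affine map `fullPmf`. -/
noncomputable def fullDir : EuclideanSpace ℝ (Fin d) →L[ℝ] (Fin (d + 1) → ℝ) :=
  ContinuousLinearMap.pi (Fin.cons (α := fun _ => EuclideanSpace ℝ (Fin d) →L[ℝ] ℝ)
    (-∑ i, EuclideanSpace.proj i) EuclideanSpace.proj)

lemma fullDir_zero_apply (u : EuclideanSpace ℝ (Fin d)) : fullDir u 0 = -∑ i, u i := by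
  simp [fullDir]

lemma fullDir_succ_apply (u : EuclideanSpace ℝ (Fin d)) (i : Fin d) : fullDir u i.succ = u i := by
  simp [fullDir]

lemma fullDir_injective : Function.Injective (fullDir (d := d)) := fun u v huv =>
  PiLp.ext fun i => by simpa only [fullDir_succ_apply] using congrFun huv i.succ

lemma fullPmf_eq_add_fullDir (θ : EuclideanSpace ℝ (Fin d)) :
    fullPmf θ = fullPmf 0 + fullDir θ := by
  ext j
  refine Fin.cases ?_ (fun i => ?_) j
  · simp [fullPmf, fullDir_zero_apply, sub_eq_add_neg]
  · simp [fullPmf, fullDir_succ_apply]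

lemma fullDir_sub (θ η : EuclideanSpace ℝ (Fin d)) :
    fullDir (θ - η) = fullPmf θ - fullPmf η := by
  rw [fullPmf_eq_add_fullDir θ, fullPmf_eq_add_fullDir η, map_sub, add_sub_add_left_eq_sub]

lemma fullPmf_injective : Function.Injective (fullPmf (d := d)) := fun θ η h =>
  sub_eq_zero.1 (fullDir_injective (by rw [fullDir_sub, h, sub_self, map_zero]))

lemma fullPmf_midpoint (θ η : EuclideanSpace ℝ (Fin d)) :
    fullPmf (midpoint ℝ θ η) = midpoint ℝ (fullPmf θ) (fullPmf η) := by
  rw [fullPmf_eq_add_fullDir (midpoint ℝ θ η), fullPmf_eq_add_fullDir θ, fullPmf_eq_add_fullDir η]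
  simp only [midpoint_eq_smul_add, map_smul, map_add, invOf_eq_inv]
  module

lemma continuous_fullPmf : Continuous (fullPmf (d := d)) := by
  rw [funext fullPmf_eq_add_fullDir]; fun_prop

lemma hasFDerivAt_fullPmf_apply (θ : EuclideanSpace ℝ (Fin d)) (j : Fin (d + 1)) :
    HasFDerivAt (fun θ => fullPmf θ j) (ContinuousLinearMap.proj j ∘L fullDir) θ := by
  rw [funext fun θ => congrFun (fullPmf_eq_add_fullDir θ) j]
  exact (ContinuousLinearMap.proj (R := ℝ) j ∘L fullDir).hasFDerivAt.const_add (fullPmf 0 j)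

lemma sum_fullPmf (θ : EuclideanSpace ℝ (Fin d)) : ∑ j, fullPmf θ j = 1 := by
  simp [Fin.sum_univ_succ, fullPmf]

lemma mem_Theta_iff : θ ∈ Theta d ↔ ∀ j, 0 < fullPmf θ j := by
  simp [Theta, Fin.forall_fin_succ, fullPmf, and_comm]

lemma isOpen_Theta : IsOpen (Theta d) := by
  have hinter : Theta d = ⋂ j, {θ | 0 < fullPmf θ j} := by ext; simp [mem_Theta_iff]
  rw [hinter]
  exact isOpen_iInter_of_finite fun j =>
    isOpen_lt continuous_const ((continuous_apply j).comp continuous_fullPmf)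

lemma fullPmf_le_one (hθ : θ ∈ Theta d) (j : Fin (d + 1)) : fullPmf θ j ≤ 1 := by
  rw [← sum_fullPmf θ]
  exact Finset.single_le_sum (fun i _ => (mem_Theta_iff.1 hθ i).le) (Finset.mem_univ j)

lemma volume_Theta_ne_top : volume (Theta d) ≠ ⊤ := by
  refine ((measure_mono fun θ hθ => ?_).trans_lt
    (measure_closedBall_lt_top (x := (0 : EuclideanSpace ℝ (Fin d))) (r := 1))).ne
  rw [mem_closedBall_zero_iff, ← sq_le_one_iff₀ (norm_nonneg _), EuclideanSpace.real_norm_sq_eq]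
  refine le_trans (Finset.sum_le_sum fun j _ => ?_) hθ.2.le
  have hle : θ j ≤ 1 := fullPmf_le_one hθ j.succ
  nlinarith [hθ.1 j]

lemma midpoint_mem_Theta {η : EuclideanSpace ℝ (Fin d)} (hθ : θ ∈ Theta d) (hη : η ∈ Theta d) :
    midpoint ℝ θ η ∈ Theta d := by
  rw [mem_Theta_iff] at *
  intro j
  have := hθ j
  have := hη j
  rw [fullPmf_midpoint, midpoint_eq_smul_add, invOf_eq_inv, Pi.smul_apply, Pi.add_apply,
    smul_eq_mul]
  positivity

lemma thetaMin_pos (hθ : θ ∈ Theta d) : 0 < thetaMin θ := by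
  obtain ⟨j, hj⟩ := exists_eq_ciInf_of_finite (f := fullPmf θ)
  rw [thetaMin, ← hj]
  exact mem_Theta_iff.1 hθ j

lemma thetaMin_le (θ : EuclideanSpace ℝ (Fin d)) (j : Fin (d + 1)) : thetaMin θ ≤ fullPmf θ j :=
  ciInf_le (Set.finite_range _).bddBelow j

lemma mem_Theta_of_chiSq_le {θs : EuclideanSpace ℝ (Fin d)} (hθs : θs ∈ Theta d)
    (h : chiSq (fullPmf θs) (fullPmf θ - fullPmf θs) ≤ thetaMin θs / 25) : θ ∈ Theta d :=
  mem_Theta_iff.2 fun j => (half_pos (mem_Theta_iff.1 hθs j)).trans_le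
    (mem_Icc_of_chiSq_sub_le (thetaMin_pos hθs) (thetaMin_le θs) le_rfl h j).1

end Simplex

section Multinomial

variable {d n : ℕ} {θ : EuclideanSpace ℝ (Fin d)}

/-- The empirical frequencies of states `1, …, d`; this is the maximum likelihood estimator as
soon as it lies in `Theta d`. -/
noncomputable def empirical (n : ℕ) (N : Fin (d + 1) → ℕ) : EuclideanSpace ℝ (Fin d) :=
  WithLp.toLp 2 fun i => (N i.succ : ℝ) / n

lemma fullPmf_empirical (hn : 0 < n) {N : Fin (d + 1) → ℕ} (hN : ∑ j, N j = n)
    (j : Fin (d + 1)) : fullPmf (empirical n N) j = N j / n := by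
  have hn' : (n : ℝ) ≠ 0 := by exact_mod_cast hn.ne'
  refine Fin.cases ?_ (fun i => by simp [fullPmf, empirical]) j
  have hsum : (N 0 : ℝ) + ∑ i : Fin d, (N i.succ : ℝ) = n := by
    rw [Fin.sum_univ_succ] at hN; exact_mod_cast hN
  simp only [fullPmf, empirical, Fin.cons_zero, ← Finset.sum_div]
  field_simp
  linarith

lemma isProbabilityMeasure_categorical (hθ : θ ∈ Theta d) :
    IsProbabilityMeasure (categorical θ) := by
  constructor
  simp only [categorical, Measure.coe_finsetSum, Measure.coe_smul, Finset.sum_apply,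
    Pi.smul_apply, measure_univ, smul_eq_mul, mul_one]
  rw [← ENNReal.ofReal_sum_of_nonneg fun j _ => (mem_Theta_iff.1 hθ j).le, sum_fullPmf,
    ENNReal.ofReal_one]

lemma integral_categorical (hθ : θ ∈ Theta d) (f : Fin (d + 1) → ℝ) :
    ∫ x, f x ∂(categorical θ) = ∑ j, fullPmf θ j * f j := by
  have := isProbabilityMeasure_categorical hθ
  rw [integral_fintype .of_finite]
  refine Finset.sum_congr rfl fun j _ => ?_
  rw [smul_eq_mul, measureReal_def, categorical, Measure.finsetSum_apply]
  simp only [Measure.smul_apply, smul_eq_mul, Measure.dirac_apply' _ (measurableSet_singleton j)]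
  rw [Finset.sum_eq_single j (fun i _ hij => by simp [hij]) (by simp)]
  simp [(mem_Theta_iff.1 hθ j).le]

lemma cast_counts_eq_sum (j : Fin (d + 1)) (x : Fin n → Fin (d + 1)) :
    (counts x j : ℝ) = ∑ i, if x i = j then (1 : ℝ) else 0 := by
  simp [counts]

lemma sum_counts (x : Fin n → Fin (d + 1)) : ∑ j, counts x j = n := by
  have h := Finset.card_eq_sum_card_fiberwise (f := x) (s := Finset.univ) (t := Finset.univ)
    (fun _ _ => by simp)
  simpa [counts] using h.symm

lemma integral_counts (hθ : θ ∈ Theta d) (j : Fin (d + 1)) :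
    ∫ x, (counts x j : ℝ) ∂(Measure.pi fun _ : Fin n => categorical θ) = n * fullPmf θ j := by
  have := isProbabilityMeasure_categorical hθ
  have hdraw : ∀ i : Fin n, ∫ x, (if x i = j then (1 : ℝ) else 0)
      ∂(Measure.pi fun _ => categorical θ) = fullPmf θ j := fun i => by
    rw [integral_comp_eval (μ := fun _ : Fin n => categorical θ) (i := i)
      (f := fun y => if y = j then (1 : ℝ) else 0) (Measurable.of_discrete.aestronglyMeasurable),
      integral_categorical hθ]
    simp
  simp_rw [cast_counts_eq_sum]
  rw [integral_finsetSum _ fun i _ => .of_finite]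
  simp [hdraw]

lemma variance_counts (hθ : θ ∈ Theta d) (j : Fin (d + 1)) :
    Var[fun x => (counts x j : ℝ); Measure.pi fun _ : Fin n => categorical θ]
      = n * (fullPmf θ j * (1 - fullPmf θ j)) := by
  have := isProbabilityMeasure_categorical hθ
  have hdraw : Var[fun y => if y = j then (1 : ℝ) else 0; categorical θ]
      = fullPmf θ j * (1 - fullPmf θ j) := by
    rw [variance_eq_sub MemLp.of_discrete, integral_categorical hθ, integral_categorical hθ]
    simp
    ring
  have hsum : (fun x : Fin n → Fin (d + 1) => (counts x j : ℝ))
      = ∑ i : Fin n, fun x : Fin n → Fin (d + 1) => if x i = j then (1 : ℝ) else 0 := by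
    ext x; simp [cast_counts_eq_sum]
  rw [hsum, variance_sum_pi (μ := fun _ : Fin n => categorical θ)
    (X := fun _ y => if y = j then (1 : ℝ) else 0) (fun _ => MemLp.of_discrete)]
  simp [hdraw]

lemma integral_chiSq_empirical (hθ : θ ∈ Theta d) (hn : 0 < n) :
    ∫ x, chiSq (fullPmf θ) (fullPmf (empirical n (counts x)) - fullPmf θ)
      ∂(Measure.pi fun _ : Fin n => categorical θ) = d / n := by
  have := isProbabilityMeasure_categorical hθ
  have hp := fun j => (mem_Theta_iff.1 hθ j).ne'
  have hn' : (n : ℝ) ≠ 0 := by exact_mod_cast hn.ne'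
  have hterm : ∀ (x : Fin n → Fin (d + 1)) j,
      (fullPmf (empirical n (counts x)) - fullPmf θ) j ^ 2 / fullPmf θ j
        = 1 / (n ^ 2 * fullPmf θ j) * ((counts x j : ℝ) - n * fullPmf θ j) ^ 2 := fun x j => by
    have := hp j
    rw [Pi.sub_apply, fullPmf_empirical hn (sum_counts x)]
    field_simp
  have hvar : ∀ j, 1 / (n ^ 2 * fullPmf θ j) * (n * (fullPmf θ j * (1 - fullPmf θ j)))
      = (1 - fullPmf θ j) / n := fun j => by
    have := hp j
    field_simp
  simp only [chiSq, hterm]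
  rw [integral_finsetSum _ fun i _ => .of_finite]
  simp_rw [integral_const_mul, ← integral_counts hθ,
    ← variance_eq_integral Measurable.of_discrete.aemeasurable, variance_counts hθ, hvar]
  rw [← Finset.sum_div, Finset.sum_sub_distrib, sum_fullPmf]
  simp

lemma one_sub_le_multinomial (hθ : θ ∈ Theta d) (hd : 0 < d) (hn : 0 < n) {K : ℝ} (hK : 0 < K) :
    1 - ENNReal.ofReal (1 / K ^ 2) ≤ multinomial n θ {N | ∑ j, N j = n ∧
      chiSq (fullPmf θ) (fullPmf (empirical n N) - fullPmf θ) ≤ K ^ 2 * (d / n)} := by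
  have := isProbabilityMeasure_categorical hθ
  set P := Measure.pi fun _ : Fin n => categorical θ
  set X : (Fin n → Fin (d + 1)) → ℝ := fun x =>
    chiSq (fullPmf θ) (fullPmf (empirical n (counts x)) - fullPmf θ)
  have hr : 0 < K ^ 2 * ((d : ℝ) / n) := by positivity
  have hmarkov : P.real {x | K ^ 2 * (d / n) ≤ X x} ≤ 1 / K ^ 2 := by
    have h := mul_meas_ge_le_integral_of_nonneg (μ := P) (f := X)
      (.of_forall fun x => chiSq_nonneg (fun j => (mem_Theta_iff.1 hθ j).le) _) .of_finite
      (K ^ 2 * (d / n))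
    rw [integral_chiSq_empirical hθ hn] at h
    rw [← mul_le_mul_iff_right₀ hr]
    refine h.trans_eq ?_
    field_simp
  rw [multinomial, Measure.map_apply Measurable.of_discrete .of_discrete]
  refine tsub_le_iff_tsub_le.1 ?_
  rw [← prob_compl_eq_one_sub .of_discrete, ← ofReal_measureReal]
  refine ENNReal.ofReal_le_ofReal ((measureReal_mono fun x hx => ?_).trans hmarkov)
  simp only [Set.mem_compl_iff, Set.mem_preimage, Set.mem_ofPred_eq, sum_counts, true_and,
    not_le] at hx
  exact hx.le

end Multinomial

section Likelihood

variable {d n : ℕ} {θ θs : EuclideanSpace ℝ (Fin d)} {N : Fin (d + 1) → ℕ}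

lemma likelihood_pos (hθ : θ ∈ Theta d) (N : Fin (d + 1) → ℕ) : 0 < likelihood N θ :=
  Finset.prod_pos fun j _ => pow_pos (mem_Theta_iff.1 hθ j) _

lemma likelihood_le_one (hθ : θ ∈ Theta d) (N : Fin (d + 1) → ℕ) : likelihood N θ ≤ 1 :=
  Finset.prod_le_one (fun j _ => pow_nonneg (mem_Theta_iff.1 hθ j).le _)
    fun j _ => pow_le_one₀ (mem_Theta_iff.1 hθ j).le (fullPmf_le_one hθ j)

lemma continuous_likelihood (N : Fin (d + 1) → ℕ) : Continuous (likelihood (d := d) N) :=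
  continuous_finsetProd _ fun j _ => ((continuous_apply j).comp continuous_fullPmf).pow _

lemma likelihood_mul_le_sq_midpoint {η : EuclideanSpace ℝ (Fin d)} (hθ : θ ∈ Theta d)
    (hη : η ∈ Theta d) (N : Fin (d + 1) → ℕ) :
    likelihood N θ * likelihood N η ≤ likelihood N (midpoint ℝ θ η) ^ 2 := by
  rw [mem_Theta_iff] at hθ hη
  simp only [likelihood, ← Finset.prod_mul_distrib, ← Finset.prod_pow]
  refine Finset.prod_le_prod (fun j _ => ?_) fun j _ => ?_
  · have := hθ j
    have := hη j
    positivity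
  · rw [← mul_pow, ← pow_mul, mul_comm (N j), pow_mul]
    refine pow_le_pow_left₀ (mul_pos (hθ j) (hη j)).le ?_ _
    rw [fullPmf_midpoint, midpoint_eq_smul_add, invOf_eq_inv, Pi.smul_apply, Pi.add_apply,
      smul_eq_mul]
    nlinarith [sq_nonneg (fullPmf θ j - fullPmf η j)]

lemma log_likelihood (hθ : θ ∈ Theta d) (N : Fin (d + 1) → ℕ) :
    Real.log (likelihood N θ) = ∑ j, (N j : ℝ) * Real.log (fullPmf θ j) := by
  rw [likelihood, Real.log_prod fun j _ => pow_ne_zero _ (mem_Theta_iff.1 hθ j).ne']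
  simp only [Real.log_pow]

lemma log_likelihood_eq_mul_logLik (hn : 0 < n) (hN : ∑ j, N j = n) (hθ : θ ∈ Theta d) :
    Real.log (likelihood N θ) = n * logLik (fullPmf (empirical n N)) (fullPmf θ) := by
  have hn' : (n : ℝ) ≠ 0 := by exact_mod_cast hn.ne'
  rw [log_likelihood hθ, logLik, Finset.mul_sum]
  refine Finset.sum_congr rfl fun j _ => ?_
  rw [fullPmf_empirical hn hN, ← mul_assoc, mul_div_cancel₀ _ hn']

lemma exp_neg_mul_nll (hn : 0 < n) (hθ : θ ∈ Theta d) (N : Fin (d + 1) → ℕ) :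
    Real.exp (-(n * nll n N θ)) = likelihood N θ := by
  have hn' : (n : ℝ) ≠ 0 := by exact_mod_cast hn.ne'
  rw [nll, show -((n : ℝ) * (-(1 / n) * Real.log (likelihood N θ)))
    = Real.log (likelihood N θ) by field_simp, Real.exp_log (likelihood_pos hθ N)]

lemma isUniqueMLE_empirical (hn : 0 < n) (hN : ∑ j, N j = n) (hmem : empirical n N ∈ Theta d) :
    IsUniqueMLE n N (empirical n N) := by
  refine ⟨hmem, fun θ hθ hne => ?_⟩
  have hn' : (0 : ℝ) < n := by exact_mod_cast hn
  have hlt : logLik (fullPmf (empirical n N)) (fullPmf θ)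
      < logLik (fullPmf (empirical n N)) (fullPmf (empirical n N)) :=
    logLik_lt_logLik_self (mem_Theta_iff.1 hmem) (mem_Theta_iff.1 hθ)
      (by rw [sum_fullPmf, sum_fullPmf]) (fullPmf_injective.ne hne)
  rw [nll, nll, log_likelihood_eq_mul_logLik hn hN hθ, log_likelihood_eq_mul_logLik hn hN hmem]
  field_simp
  linarith

end Likelihood

section Fisher

variable {d n : ℕ} {θ θs : EuclideanSpace ℝ (Fin d)} {s : ℝ}

lemma popNll_eq (hθs : θs ∈ Theta d) (hn : 0 < n) (hθ : θ ∈ Theta d) :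
    popNll n θs θ = -logLik (fullPmf θs) (fullPmf θ) := by
  have := isProbabilityMeasure_categorical hθs
  have hn' : (n : ℝ) ≠ 0 := by exact_mod_cast hn.ne'
  rw [popNll, multinomial, integral_map Measurable.of_discrete.aemeasurable
    Measurable.of_discrete.aestronglyMeasurable]
  simp_rw [nll, log_likelihood hθ]
  rw [integral_const_mul, integral_finsetSum _ fun i _ => .of_finite, logLik, Finset.mul_sum,
    ← Finset.sum_neg_distrib]
  simp_rw [integral_mul_const, integral_counts hθs]
  refine Finset.sum_congr rfl fun j _ => ?_
  field_simp

lemma fderiv_popNll (hθs : θs ∈ Theta d) (hn : 0 < n) (hθ : θ ∈ Theta d) :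
    fderiv ℝ (popNll n θs) θ = ∑ j, (-fullPmf θs j * (fullPmf θ j)⁻¹) •
      (ContinuousLinearMap.proj j ∘L fullDir) := by
  have hmem : ∀ᶠ η in 𝓝 θ, η ∈ Theta d := isOpen_Theta.mem_nhds hθ
  have hloc : popNll n θs =ᶠ[𝓝 θ] fun η => ∑ j, -fullPmf θs j * Real.log (fullPmf η j) :=
    hmem.mono fun η hη => by
      simp only [popNll_eq hθs hn hη, logLik, neg_mul, Finset.sum_neg_distrib]
  rw [hloc.fderiv_eq]
  refine (HasFDerivAt.fun_sum fun j _ => ?_).fderiv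
  rw [mul_smul]
  exact ((hasFDerivAt_fullPmf_apply θ j).log (mem_Theta_iff.1 hθ j).ne').const_mul _

lemma fisher_apply (hθs : θs ∈ Theta d) (hn : 0 < n) (i k : Fin d) :
    fisher n θs i k = ∑ j, fullDir (EuclideanSpace.single i 1) j
      * fullDir (EuclideanSpace.single k 1) j / fullPmf θs j := by
  have hmem : ∀ᶠ η in 𝓝 θs, η ∈ Theta d := isOpen_Theta.mem_nhds hθs
  have hloc : fderiv ℝ (popNll n θs) =ᶠ[𝓝 θs] fun θ => ∑ j, (-fullPmf θs j * (fullPmf θ j)⁻¹) •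
      (ContinuousLinearMap.proj j ∘L fullDir) :=
    hmem.mono fun θ hθ => fderiv_popNll hθs hn hθ
  have hderiv : HasFDerivAt (fun θ => ∑ j, (-fullPmf θs j * (fullPmf θ j)⁻¹) •
      (ContinuousLinearMap.proj (R := ℝ) j ∘L fullDir (d := d)))
      (∑ j, ((-fullPmf θs j) • (-(fullPmf θs j ^ 2)⁻¹ •
        (ContinuousLinearMap.proj j ∘L fullDir))).smulRight
          (ContinuousLinearMap.proj j ∘L fullDir)) θs := by
    refine HasFDerivAt.fun_sum fun j _ => ?_
    exact (((hasDerivAt_inv (mem_Theta_iff.1 hθs j).ne').comp_hasFDerivAt θs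
      (hasFDerivAt_fullPmf_apply θs j)).const_mul (-fullPmf θs j)).smul_const
        (ContinuousLinearMap.proj (R := ℝ) j ∘L fullDir (d := d))
  rw [fisher, hessian, Matrix.of_apply, iteratedFDeriv_two_apply, hloc.fderiv_eq, hderiv.fderiv]
  simp only [Matrix.cons_val_zero, Matrix.cons_val_one, sum_apply,
    ContinuousLinearMap.smulRight_apply, smul_apply, smul_eq_mul,
    ContinuousLinearMap.comp_apply, ContinuousLinearMap.proj_apply]
  refine Finset.sum_congr rfl fun j _ => ?_
  have := (mem_Theta_iff.1 hθs j).ne'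
  field_simp

lemma fullDir_eq_sum (u : EuclideanSpace ℝ (Fin d)) (j : Fin (d + 1)) :
    fullDir u j = ∑ i, u i * fullDir (EuclideanSpace.single i 1) j := by
  conv_lhs => rw [← (EuclideanSpace.basisFun (Fin d) ℝ).sum_repr u]
  simp

lemma dotProduct_fisher_mulVec (hθs : θs ∈ Theta d) (hn : 0 < n)
    (u : EuclideanSpace ℝ (Fin d)) :
    u.ofLp ⬝ᵥ (fisher n θs *ᵥ u.ofLp) = chiSq (fullPmf θs) (fullDir u) := by
  simp only [dotProduct, Matrix.mulVec, fisher_apply hθs hn, chiSq]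
  simp_rw [Finset.sum_mul, Finset.mul_sum]
  rw [Finset.sum_congr rfl fun i _ => Finset.sum_comm, Finset.sum_comm]
  refine Finset.sum_congr rfl fun j _ => ?_
  rw [fullDir_eq_sum u j, pow_two, Finset.sum_mul_sum, Finset.sum_div]
  refine Finset.sum_congr rfl fun i _ => ?_
  rw [Finset.sum_div]
  exact Finset.sum_congr rfl fun k _ => by ring

lemma posDef_fisher (hθs : θs ∈ Theta d) (hn : 0 < n) : (fisher n θs).PosDef := by
  refine Matrix.PosDef.of_dotProduct_mulVec_pos ?_ fun x hx => ?_
  · ext i k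
    simp only [Matrix.conjTranspose_apply, fisher_apply hθs hn, star_trivial]
    exact Finset.sum_congr rfl fun j _ => by ring
  · rw [star_trivial]
    refine (dotProduct_fisher_mulVec hθs hn (WithLp.toLp 2 x)).symm.subst
      (chiSq_pos (mem_Theta_iff.1 hθs) fun h => hx ?_)
    simpa using (map_eq_zero_iff _ fullDir_injective).1 h

lemma wNorm_fisher (hθs : θs ∈ Theta d) (hn : 0 < n) (u : EuclideanSpace ℝ (Fin d)) :
    wNorm (fisher n θs) u = √(chiSq (fullPmf θs) (fullDir u)) := by
  rw [wNorm, dotProduct_fisher_mulVec hθs hn]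

lemma exists_gammaStar_eq_withDensity (hθs : θs ∈ Theta d) (hn : 0 < n)
    (θh : EuclideanSpace ℝ (Fin d)) :
    ∃ k : ℝ, 0 < k ∧ gammaStar n θs θh = volume.withDensity fun x => ENNReal.ofReal
      (k * Real.exp (-(n * chiSq (fullPmf θs) (fullPmf x - fullPmf θh)) / 2)) := by
  have hn' : (0 : ℝ) < n := by exact_mod_cast hn
  obtain ⟨k, hk, hdensity⟩ := exists_multivariateGaussian_inv_eq_withDensity
    ((posDef_fisher hθs hn).smul hn') θh
  refine ⟨k, hk, ?_⟩
  rw [gammaStar, hdensity]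
  simp_rw [Matrix.smul_mulVec, dotProduct_smul, dotProduct_fisher_mulVec hθs hn, smul_eq_mul,
    fullDir_sub]

lemma mem_nbhd_iff (hθs : θs ∈ Theta d) (hn : 0 < n) (hs : 0 ≤ s) :
    θ ∈ nbhd n θs s ↔ chiSq (fullPmf θs) (fullPmf θ - fullPmf θs) ≤ s ^ 2 * (d / n) := by
  rw [nbhd, Set.mem_ofPred_eq, wNorm_fisher hθs hn, fullDir_sub, Real.sqrt_le_left (by positivity),
    mul_pow, Real.sq_sqrt (by positivity)]

lemma center_mem_nbhd (hθs : θs ∈ Theta d) (hn : 0 < n) (hs : 0 ≤ s) : θs ∈ nbhd n θs s := by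
  rw [mem_nbhd_iff hθs hn hs, sub_self, chiSq]
  simp only [Pi.zero_apply, ne_eq, OfNat.ofNat_ne_zero, not_false_eq_true, zero_pow, zero_div,
    Finset.sum_const_zero]
  positivity

lemma isClosed_nbhd (hθs : θs ∈ Theta d) (hn : 0 < n) (hs : 0 ≤ s) :
    IsClosed (nbhd n θs s) := by
  have hset : nbhd n θs s =
      {θ | chiSq (fullPmf θs) (fullPmf θ - fullPmf θs) ≤ s ^ 2 * (d / n)} :=
    Set.ext fun _ => mem_nbhd_iff hθs hn hs
  rw [hset]
  exact isClosed_le ((continuous_chiSq _).comp (continuous_fullPmf.sub continuous_const))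
    continuous_const

lemma convex_nbhd (hθs : θs ∈ Theta d) (hn : 0 < n) (hs : 0 ≤ s) : Convex ℝ (nbhd n θs s) := by
  have hpre : nbhd n θs s = (fun θ => -θs + θ) ⁻¹' (fullDir ⁻¹'
      {v | chiSq (fullPmf θs) (v - 0) ≤ s ^ 2 * (d / n)}) := by
    ext θ
    simp only [mem_nbhd_iff hθs hn hs, ← fullDir_sub, Set.mem_preimage, Set.mem_ofPred_eq,
      sub_zero, neg_add_eq_sub]
  rw [hpre]
  exact ((convex_setOf_chiSq_sub_le (fun j => (mem_Theta_iff.1 hθs j).le) 0 _).linear_preimage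
    (fullDir (d := d)).toLinearMap).translate_preimage_right (-θs)

end Fisher

section Prior

variable {d n : ℕ} {θs : EuclideanSpace ℝ (Fin d)} {ρ : EuclideanSpace ℝ (Fin d) → ℝ} {s δ : ℝ}

lemma apply_le_of_dualNorm_le (hθs : θs ∈ Theta d) (hn : 0 < n)
    {S : EuclideanSpace ℝ (Fin d) →L[ℝ] ℝ} (hδ : 0 ≤ δ)
    (hS : dualNorm (fisher n θs) S ≤ ENNReal.ofReal δ) (u : EuclideanSpace ℝ (Fin d)) :
    S u ≤ δ * √(chiSq (fullPmf θs) (fullDir u)) := by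
  rcases eq_or_ne u 0 with rfl | hu
  · rw [map_zero]; positivity
  set Q := chiSq (fullPmf θs) (fullDir u) with hQ
  have hQ0 : 0 < Q := chiSq_pos (mem_Theta_iff.1 hθs) ((map_ne_zero_iff _ fullDir_injective).2 hu)
  have hunit : wNorm (fisher n θs) ((√Q)⁻¹ • u) = 1 := by
    rw [wNorm_fisher hθs hn, map_smul, chiSq_smul, ← hQ, inv_pow, Real.sq_sqrt hQ0.le,
      inv_mul_cancel₀ hQ0.ne', Real.sqrt_one]
  have hle : ENNReal.ofReal (S ((√Q)⁻¹ • u)) ≤ ENNReal.ofReal δ :=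
    (le_iSup₂ (f := fun (v : EuclideanSpace ℝ (Fin d)) (_ : wNorm (fisher n θs) v = 1) =>
      ENNReal.ofReal (S v)) _ hunit).trans hS
  rwa [ENNReal.ofReal_le_ofReal_iff hδ, map_smul, smul_eq_mul,
    inv_mul_le_iff₀ (Real.sqrt_pos.2 hQ0), mul_comm] at hle

lemma contDiffAt_and_pos_and_dualNorm_le_of_delta01_le (hδ : delta01 n ρ θs s ≤ ENNReal.ofReal δ)
    {θ : EuclideanSpace ℝ (Fin d)} (hθ : θ ∈ nbhd n θs s) :
    ContDiffAt ℝ 1 ρ θ ∧ 0 < ρ θ ∧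
      dualNorm (fisher n θs) (fderiv ℝ (fun η => Real.log (ρ η)) θ) ≤ ENNReal.ofReal δ := by
  rw [delta01] at hδ
  split_ifs at hδ with hreg
  · exact ⟨(hreg θ hθ).1, (hreg θ hθ).2, (le_iSup₂ (f := fun (v : EuclideanSpace ℝ (Fin d))
      (_ : v ∈ nbhd n θs s) => dualNorm (fisher n θs) (fderiv ℝ (fun η => Real.log (ρ η)) v))
      θ hθ).trans hδ⟩
  · simp at hδ

lemma log_prior_sub_le (hθs : θs ∈ Theta d) (hn : 0 < n) (hs : 0 ≤ s) (hδ0 : 0 ≤ δ)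
    (hδ : delta01 n ρ θs s ≤ ENNReal.ofReal δ) {x y : EuclideanSpace ℝ (Fin d)}
    (hx : x ∈ nbhd n θs s) (hy : y ∈ nbhd n θs s) :
    Real.log (ρ x) - Real.log (ρ y) ≤ δ * √(chiSq (fullPmf θs) (fullPmf x - fullPmf y)) := by
  have hseg : ∀ t ∈ Set.Icc (0 : ℝ) 1, AffineMap.lineMap y x t ∈ nbhd n θs s := fun t ht =>
    (convex_nbhd hθs hn hs).lineMap_mem hy hx ht
  have hderiv : ∀ t ∈ Set.Icc (0 : ℝ) 1,
      HasDerivAt (fun t => Real.log (ρ (AffineMap.lineMap y x t)))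
        (fderiv ℝ (fun η => Real.log (ρ η)) (AffineMap.lineMap y x t) (x - y)) t := fun t ht => by
    obtain ⟨hdiff, hpos, -⟩ := contDiffAt_and_pos_and_dualNorm_le_of_delta01_le hδ (hseg t ht)
    exact ((hdiff.differentiableAt one_ne_zero).log hpos.ne').hasFDerivAt.comp_hasDerivAt t
      AffineMap.hasDerivAt_lineMap
  obtain ⟨t, ht, hslope⟩ := exists_hasDerivAt_eq_slope _ _ zero_lt_one
    (fun t ht => (hderiv t ht).continuousAt.continuousWithinAt)
    (fun t ht => hderiv t (Set.Ioo_subset_Icc_self ht))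
  rw [AffineMap.lineMap_apply_zero, AffineMap.lineMap_apply_one, sub_zero, div_one] at hslope
  rw [← hslope, ← fullDir_sub]
  exact apply_le_of_dualNorm_le hθs hn hδ0 (contDiffAt_and_pos_and_dualNorm_le_of_delta01_le hδ
    (hseg t (Set.Ioo_subset_Icc_self ht))).2.2 _

lemma exp_neg_mul_prior_le (hθs : θs ∈ Theta d) (hd : 0 < d) (hn : 0 < n) (hs : 0 ≤ s)
    (hδ0 : 0 ≤ δ) (hδ : delta01 n ρ θs s ≤ ENNReal.ofReal δ) (hδs : δ * s ≤ √n)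
    {x : EuclideanSpace ℝ (Fin d)} (hx : x ∈ nbhd n θs s) :
    Real.exp (-d) * ρ θs ≤ ρ x := by
  have hd' : (1 : ℝ) ≤ d := by exact_mod_cast hd
  have : 0 < √(n : ℝ) := by positivity
  have hctr := center_mem_nbhd hθs hn hs
  have hpos : ∀ {θ}, θ ∈ nbhd n θs s → 0 < ρ θ := fun hθ =>
    (contDiffAt_and_pos_and_dualNorm_le_of_delta01_le hδ hθ).2.1
  have hosc : Real.log (ρ θs) - Real.log (ρ x) ≤ d := by
    calc Real.log (ρ θs) - Real.log (ρ x)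
        ≤ δ * √(chiSq (fullPmf θs) (fullPmf x - fullPmf θs)) := by
          rw [chiSq_sub_comm]; exact log_prior_sub_le hθs hn hs hδ0 hδ hctr hx
      _ ≤ δ * √(s ^ 2 * (d / n)) := by gcongr; exact (mem_nbhd_iff hθs hn hs).1 hx
      _ = δ * s * √d / √n := by
          rw [Real.sqrt_mul (sq_nonneg s), Real.sqrt_sq hs, Real.sqrt_div (by positivity)]
          ring
      _ ≤ √n * √d / √n := by gcongr
      _ = √d := by field_simp
      _ ≤ d := Real.sqrt_le_left (by positivity) |>.2 (by nlinarith)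
  rw [← Real.exp_log (hpos hx), ← Real.exp_log (hpos hctr), ← Real.exp_add, Real.exp_le_exp]
  linarith

lemma prior_le_of_M0_le (hd : 0 < d) (hρs : 0 < ρ θs) {C : ℝ} (hC : M0 ρ θs ≤ (C : EReal))
    {θ : EuclideanSpace ℝ (Fin d)} (hθ : θ ∈ Theta d) : ρ θ ≤ Real.exp (C * d) * ρ θs := by
  rcases le_or_gt (ρ θ) 0 with hρ | hρ
  · exact hρ.trans (by positivity)
  have hd' : (0 : ℝ) < d := by exact_mod_cast hd
  have hratio : 0 < ρ θ / ρ θs := div_pos hρ hρs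
  have hle : ENNReal.ofReal (ρ θ / ρ θs) ≤ ⨆ η ∈ Theta d, ENNReal.ofReal (ρ η / ρ θs) :=
    le_iSup₂ (f := fun η (_ : η ∈ Theta d) => ENNReal.ofReal (ρ η / ρ θs)) θ hθ
  have hlog : (((d : ℝ)⁻¹ : ℝ) : EReal) * ENNReal.log (ENNReal.ofReal (ρ θ / ρ θs)) ≤ (C : EReal) :=
    (mul_le_mul_of_nonneg_left (ENNReal.log_monotone hle)
      (EReal.coe_nonneg.2 (inv_nonneg.2 hd'.le))).trans hC
  rw [ENNReal.log_ofReal_of_pos hratio, ← EReal.coe_mul, EReal.coe_le_coe_iff,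
    inv_mul_le_iff₀ hd', Real.log_le_iff_le_exp hratio, div_le_iff₀ hρs, mul_comm (d : ℝ)] at hlog
  exact hlog

end Prior

section Comparable

variable {α : Type*} [MeasurableSpace α] {μ : Measure α} {f w : α → ℝ≥0∞} {U : Set α}

lemma lintegral_le_two_mul_setLIntegral (hU : MeasurableSet U) (hfin : ∫⁻ x, f x ∂μ ≠ ⊤)
    (htail : ∫⁻ x in Uᶜ, f x ∂μ ≤ 2⁻¹ * ∫⁻ x, f x ∂μ) :
    ∫⁻ x, f x ∂μ ≤ 2 * ∫⁻ x in U, f x ∂μ := by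
  have hhalf : 2⁻¹ * ∫⁻ x, f x ∂μ ≠ ⊤ := ENNReal.mul_ne_top (by simp) hfin
  have hsplit : 2⁻¹ * ∫⁻ x, f x ∂μ + 2⁻¹ * ∫⁻ x, f x ∂μ
      ≤ ∫⁻ x in U, f x ∂μ + 2⁻¹ * ∫⁻ x, f x ∂μ := by
    rw [← add_mul, ENNReal.inv_two_add_inv_two, one_mul, ← lintegral_add_compl f hU]
    gcongr
    rwa [lintegral_add_compl f hU]
  have hle := (ENNReal.add_le_add_iff_right hhalf).1 hsplit
  rwa [mul_comm, ← div_eq_mul_inv, ENNReal.div_le_iff_le_mul (by simp) (by simp), mul_comm] at hle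

lemma mul_setLIntegral_compl_le_of_comparable {κ M c : ℝ≥0∞} (hU : MeasurableSet U)
    (hκ : κ ≤ 2⁻¹) (hM : M ≠ ⊤) (hwM : ∀ x ∈ Uᶜ, w x ≤ M * f x) (hwc : ∀ x ∈ U, c * f x ≤ w x)
    (hfin : ∫⁻ x, f x ∂μ ≠ ⊤) (htail : ∫⁻ x in Uᶜ, f x ∂μ ≤ κ * ∫⁻ x, f x ∂μ) :
    c * ∫⁻ x in Uᶜ, w x ∂μ ≤ 2 * M * κ * ∫⁻ x in U, w x ∂μ := by
  have hbulk := lintegral_le_two_mul_setLIntegral hU hfin (htail.trans (by gcongr))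
  calc c * ∫⁻ x in Uᶜ, w x ∂μ
      ≤ c * (M * ∫⁻ x in Uᶜ, f x ∂μ) := by
        rw [← lintegral_const_mul' _ _ hM]
        gcongr c * ?_
        exact setLIntegral_mono' hU.compl hwM
    _ ≤ c * (M * (κ * (2 * ∫⁻ x in U, f x ∂μ))) := by
        gcongr c * (M * ?_)
        exact htail.trans (by gcongr)
    _ = 2 * M * κ * (c * ∫⁻ x in U, f x ∂μ) := by ring
    _ ≤ 2 * M * κ * ∫⁻ x in U, w x ∂μ := by
        gcongr
        exact (lintegral_const_mul_le _ _).trans (setLIntegral_mono' hU hwc)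

end Comparable

section Tails

variable {d n : ℕ} {θs θh : EuclideanSpace ℝ (Fin d)} {N : Fin (d + 1) → ℕ} {s : ℝ}

/-- The likelihood as a function on the whole space, extended by zero outside `Theta d`. -/
noncomputable def likelihoodOn (N : Fin (d + 1) → ℕ) : EuclideanSpace ℝ (Fin d) → ℝ :=
  (Theta d).indicator (likelihood N)

/-- The mass relative to the total that a log-concave density with the curvature of the
log-likelihood is allowed to have outside `nbhd n θs s`. -/
noncomputable def tailBound (d : ℕ) (s : ℝ) : ℝ := Real.exp (-(s ^ 2 * d / 64)) * 2 ^ d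

lemma tailBound_nonneg (d : ℕ) (s : ℝ) : 0 ≤ tailBound d s := by
  unfold tailBound; positivity

lemma ofReal_tailBound (d : ℕ) (s : ℝ) :
    ENNReal.ofReal (tailBound d s) = ENNReal.ofReal (Real.exp (-(s ^ 2 * d / 64))) * 2 ^ d := by
  rw [tailBound, ENNReal.ofReal_mul (Real.exp_pos _).le, ENNReal.ofReal_pow zero_le_two,
    ENNReal.ofReal_ofNat]

lemma likelihoodOn_of_mem {θ : EuclideanSpace ℝ (Fin d)} (hθ : θ ∈ Theta d)
    (N : Fin (d + 1) → ℕ) : likelihoodOn N θ = likelihood N θ :=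
  Set.indicator_of_mem hθ _

lemma likelihoodOn_of_notMem {θ : EuclideanSpace ℝ (Fin d)} (hθ : θ ∉ Theta d)
    (N : Fin (d + 1) → ℕ) : likelihoodOn N θ = 0 :=
  Set.indicator_of_notMem hθ _

lemma likelihoodOn_nonneg (N : Fin (d + 1) → ℕ) (θ : EuclideanSpace ℝ (Fin d)) :
    0 ≤ likelihoodOn N θ :=
  Set.indicator_nonneg (fun _ hθ => (likelihood_pos hθ N).le) θ

lemma measurable_likelihoodOn (N : Fin (d + 1) → ℕ) : Measurable (likelihoodOn (d := d) N) :=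
  (continuous_likelihood N).measurable.indicator isOpen_Theta.measurableSet

lemma lintegral_likelihoodOn_ne_top (N : Fin (d + 1) → ℕ) :
    ∫⁻ θ : EuclideanSpace ℝ (Fin d), ENNReal.ofReal (likelihoodOn N θ) ≠ ⊤ := by
  refine ne_top_of_le_ne_top (volume_Theta_ne_top (d := d)) ?_
  rw [← lintegral_indicator_one isOpen_Theta.measurableSet]
  refine lintegral_mono fun θ => ?_
  by_cases hθ : θ ∈ Theta d
  · simpa [likelihoodOn, hθ] using likelihood_le_one hθ N
  · simp [likelihoodOn, hθ]

lemma likelihoodOn_mul_le_sq_midpoint (N : Fin (d + 1) → ℕ) (hθh : θh ∈ Theta d)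
    (x : EuclideanSpace ℝ (Fin d)) :
    likelihoodOn N x * likelihood N θh ≤ likelihoodOn N (midpoint ℝ θh x) ^ 2 := by
  by_cases hx : x ∈ Theta d
  · rw [likelihoodOn_of_mem hx, likelihoodOn_of_mem (midpoint_mem_Theta hθh hx), mul_comm]
    exact likelihood_mul_le_sq_midpoint hθh hx N
  · rw [likelihoodOn_of_notMem hx, zero_mul]
    positivity

lemma le_chiSq_sub_of_notMem_nbhd (hθs : θs ∈ Theta d) (hn : 0 < n) (hs : 0 ≤ s)
    (hθh : 4 * chiSq (fullPmf θs) (fullPmf θh - fullPmf θs) ≤ s ^ 2 * (d / n))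
    {x : EuclideanSpace ℝ (Fin d)} (hx : x ∉ nbhd n θs s) :
    s ^ 2 * (d / n) / 4 ≤ chiSq (fullPmf θs) (fullPmf x - fullPmf θh) := by
  rw [mem_nbhd_iff hθs hn hs, not_le] at hx
  have htri := chiSq_sub_le (fun j => (mem_Theta_iff.1 hθs j).le) (fullPmf x - fullPmf θh)
    (fullPmf θs - fullPmf θh)
  rw [sub_sub_sub_cancel_right, chiSq_sub_comm _ (fullPmf θs)] at htri
  linarith

lemma empirical_mem_Theta (hθs : θs ∈ Theta d) (hsmall : s ^ 2 * (d / n) ≤ thetaMin θs / 25)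
    (hhat : 4 * chiSq (fullPmf θs) (fullPmf (empirical n N) - fullPmf θs) ≤ s ^ 2 * (d / n)) :
    empirical n N ∈ Theta d := by
  have := chiSq_nonneg (fun j => (mem_Theta_iff.1 hθs j).le) (fullPmf (empirical n N) - fullPmf θs)
  exact mem_Theta_of_chiSq_le hθs (by linarith)

lemma likelihoodOn_le_of_notMem_nbhd (hθs : θs ∈ Theta d) (hd : 0 < d) (hn : 0 < n)
    (hN : ∑ j, N j = n) (hs : 0 < s) (hsmall : s ^ 2 * (d / n) ≤ thetaMin θs / 25)
    (hhat : 4 * chiSq (fullPmf θs) (fullPmf (empirical n N) - fullPmf θs) ≤ s ^ 2 * (d / n))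
    {x : EuclideanSpace ℝ (Fin d)} (hx : x ∉ nbhd n θs s) :
    likelihoodOn N x ≤ Real.exp (-(s ^ 2 * d / 64)) ^ 2 * likelihood N (empirical n N) := by
  have hn' : (0 : ℝ) < n := by exact_mod_cast hn
  have : (0 : ℝ) < d := by exact_mod_cast hd
  have hmem := empirical_mem_Theta hθs hsmall hhat
  have hpos := likelihood_pos hmem N
  by_cases hxΘ : x ∈ Theta d
  · have hhat0 := chiSq_nonneg (fun j => (mem_Theta_iff.1 hθs j).le)
      (fullPmf (empirical n N) - fullPmf θs)
    have hdrop : logLik (fullPmf (empirical n N)) (fullPmf x)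
        ≤ logLik (fullPmf (empirical n N)) (fullPmf (empirical n N)) - s ^ 2 * (d / n) / 32 :=
      logLik_le_sub_of_le_chiSq (thetaMin_pos hθs) (thetaMin_le θs) hsmall (by positivity)
        (by rw [sum_fullPmf, sum_fullPmf]) (mem_Theta_iff.1 hxΘ) (by linarith)
        (le_chiSq_sub_of_notMem_nbhd hθs hn hs.le hhat hx)
    rw [likelihoodOn_of_mem hxΘ, ← Real.exp_log (likelihood_pos hxΘ N), ← Real.exp_log hpos,
      ← Real.exp_nat_mul, ← Real.exp_add, Real.exp_le_exp, log_likelihood_eq_mul_logLik hn hN hxΘ,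
      log_likelihood_eq_mul_logLik hn hN hmem]
    refine (mul_le_mul_of_nonneg_left hdrop hn'.le).trans_eq ?_
    push_cast
    field_simp
    ring
  · rw [likelihoodOn_of_notMem hxΘ]
    positivity

lemma setLIntegral_likelihoodOn_compl_nbhd_le (hθs : θs ∈ Theta d) (hd : 0 < d) (hn : 0 < n)
    (hN : ∑ j, N j = n) (hs : 0 < s) (hsmall : s ^ 2 * (d / n) ≤ thetaMin θs / 25)
    (hhat : 4 * chiSq (fullPmf θs) (fullPmf (empirical n N) - fullPmf θs) ≤ s ^ 2 * (d / n)) :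
    ∫⁻ x in (nbhd n θs s)ᶜ, ENNReal.ofReal (likelihoodOn N x)
      ≤ ENNReal.ofReal (tailBound d s) * ∫⁻ x, ENNReal.ofReal (likelihoodOn N x) := by
  rw [ofReal_tailBound]
  simpa only [finrank_euclideanSpace_fin] using
    setLIntegral_le_of_le_sq_midpoint volume (measurable_likelihoodOn N) (likelihoodOn_nonneg N)
      (Real.exp_pos _).le
      (likelihoodOn_mul_le_sq_midpoint N (empirical_mem_Theta hθs hsmall hhat))
      (isClosed_nbhd hθs hn hs.le).measurableSet.compl
      fun _ hx => likelihoodOn_le_of_notMem_nbhd hθs hd hn hN hs hsmall hhat hx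

lemma isProbabilityMeasure_gammaStar (n : ℕ) (θs θh : EuclideanSpace ℝ (Fin d)) :
    IsProbabilityMeasure (gammaStar n θs θh) := by
  rw [gammaStar]; infer_instance

lemma gammaStar_compl_nbhd_le (hθs : θs ∈ Theta d) (hn : 0 < n) (hs : 0 ≤ s)
    (hθh : 4 * chiSq (fullPmf θs) (fullPmf θh - fullPmf θs) ≤ s ^ 2 * (d / n)) :
    gammaStar n θs θh (nbhd n θs s)ᶜ ≤ ENNReal.ofReal (tailBound d s) := by
  have hn' : (0 : ℝ) < n := by exact_mod_cast hn
  obtain ⟨k, hk, hγ⟩ := exists_gammaStar_eq_withDensity hθs hn θh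
  have := isProbabilityMeasure_gammaStar n θs θh
  have hU := (isClosed_nbhd hθs hn hs).measurableSet.compl
  have hmid (x : EuclideanSpace ℝ (Fin d)) :
      k * Real.exp (-(n * chiSq (fullPmf θs) (fullPmf x - fullPmf θh)) / 2) * k
        ≤ (k * Real.exp (-(n * chiSq (fullPmf θs) (fullPmf (midpoint ℝ θh x) - fullPmf θh)) / 2))
          ^ 2 := by
    have hQ := mul_nonneg hn'.le (chiSq_nonneg (fun j => (mem_Theta_iff.1 hθs j).le)
      (fullPmf x - fullPmf θh))
    rw [fullPmf_midpoint, midpoint_sub_left, chiSq_smul, mul_pow, ← Real.exp_nat_mul,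
      mul_right_comm, ← pow_two, invOf_eq_inv]
    refine mul_le_mul_of_nonneg_left (Real.exp_le_exp.2 ?_) (sq_nonneg k)
    push_cast
    linarith
  have hfar : ∀ x ∈ (nbhd n θs s)ᶜ,
      k * Real.exp (-(n * chiSq (fullPmf θs) (fullPmf x - fullPmf θh)) / 2)
        ≤ Real.exp (-(s ^ 2 * d / 64)) ^ 2 * k := fun x hx => by
    have hQ := mul_le_mul_of_nonneg_left (le_chiSq_sub_of_notMem_nbhd hθs hn hs hθh hx) hn'.le
    rw [mul_comm k, ← Real.exp_nat_mul]
    gcongr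
    have : 0 ≤ s ^ 2 * d := by positivity
    field_simp at hQ ⊢
    push_cast
    linarith
  have := continuous_chiSq (fullPmf θs)
  have := continuous_fullPmf (d := d)
  have htail := setLIntegral_le_of_le_sq_midpoint volume (by fun_prop)
    (fun x => by positivity) (Real.exp_pos (-(s ^ 2 * d / 64))).le hmid hU hfar
  rwa [← withDensity_apply _ hU, ← setLIntegral_univ, ← withDensity_apply _ .univ, ← hγ,
    measure_univ, mul_one, finrank_euclideanSpace_fin, ← ofReal_tailBound] at htail

end Tails

section Posterior

variable {d n : ℕ} {θs : EuclideanSpace ℝ (Fin d)} {N : Fin (d + 1) → ℕ}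
  {ρ : EuclideanSpace ℝ (Fin d) → ℝ} {s b δ η κ : ℝ}

lemma unnormPosterior_eq_withDensity (hn : 0 < n) (ρ : EuclideanSpace ℝ (Fin d) → ℝ)
    (N : Fin (d + 1) → ℕ) : unnormPosterior n ρ N =
      volume.withDensity fun θ => ENNReal.ofReal (likelihoodOn N θ * ρ θ) := by
  have hdensity : (fun θ => ENNReal.ofReal (likelihoodOn N θ * ρ θ)) = (Theta d).indicator
      fun θ => ENNReal.ofReal (Real.exp (-(n * nll n N θ)) * ρ θ) := by
    ext θ
    by_cases hθ : θ ∈ Theta d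
    · rw [Set.indicator_of_mem hθ, likelihoodOn_of_mem hθ, exp_neg_mul_nll hn hθ]
    · rw [Set.indicator_of_notMem hθ, likelihoodOn_of_notMem hθ, zero_mul, ENNReal.ofReal_zero]
  rw [hdensity, withDensity_indicator isOpen_Theta.measurableSet, unnormPosterior]

lemma unnormPosterior_univ_ne_top (hn : 0 < n) (N : Fin (d + 1) → ℕ)
    (hρ0 : ∀ θ, 0 ≤ ρ θ) (hρb : ∀ θ ∈ Theta d, ρ θ ≤ b) : unnormPosterior n ρ N Set.univ ≠ ⊤ := by
  rw [unnormPosterior, withDensity_apply _ .univ, setLIntegral_univ]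
  refine ne_top_of_le_ne_top (ENNReal.mul_ne_top (ENNReal.ofReal_ne_top (r := b))
    (volume_Theta_ne_top (d := d))) ?_
  rw [← setLIntegral_const]
  refine setLIntegral_mono' isOpen_Theta.measurableSet fun θ hθ => ENNReal.ofReal_le_ofReal ?_
  rw [exp_neg_mul_nll hn hθ]
  exact (mul_le_of_le_one_left (hρ0 θ) (likelihood_le_one hθ N)).trans (hρb θ hθ)

lemma unnormPosterior_univ_ne_zero (hθs : θs ∈ Theta d) (hn : 0 < n) (N : Fin (d + 1) → ℕ)
    (hρm : Measurable ρ) (hρc : ContinuousAt ρ θs) (hρs : 0 < ρ θs) :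
    unnormPosterior n ρ N Set.univ ≠ 0 := by
  rw [unnormPosterior_eq_withDensity hn, withDensity_apply _ .univ, setLIntegral_univ]
  have hmeas : Measurable fun θ => likelihoodOn N θ * ρ θ := (measurable_likelihoodOn N).mul hρm
  refine ((lintegral_pos_iff_support hmeas.ennreal_ofReal).2 ?_).ne'
  have hpos : ∀ᶠ θ in 𝓝 θs, 0 < ρ θ := hρc.eventually_const_lt hρs
  refine Measure.measure_pos_of_mem_nhds (x := θs) volume ?_
  filter_upwards [hpos, isOpen_Theta.mem_nhds hθs] with θ hρθ hθ
  rw [Function.mem_support, likelihoodOn_of_mem hθ]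
  exact (ENNReal.ofReal_pos.2 (mul_pos (likelihood_pos hθ N) hρθ)).ne'

lemma isProbabilityMeasure_posterior (h0 : unnormPosterior n ρ N Set.univ ≠ 0)
    (ht : unnormPosterior n ρ N Set.univ ≠ ⊤) : IsProbabilityMeasure (posterior n ρ N) :=
  ⟨by rw [posterior, Measure.smul_apply, smul_eq_mul, ENNReal.inv_mul_cancel h0 ht]⟩

lemma exists_posterior_eq_withDensity (hn : 0 < n) (hρm : Measurable ρ)
    (h0 : unnormPosterior n ρ N Set.univ ≠ 0) (ht : unnormPosterior n ρ N Set.univ ≠ ⊤) :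
    ∃ k : ℝ, 0 < k ∧ posterior n ρ N =
      volume.withDensity fun θ => ENNReal.ofReal (k * (likelihoodOn N θ * ρ θ)) := by
  have hZ := ENNReal.toReal_pos h0 ht
  refine ⟨(unnormPosterior n ρ N Set.univ).toReal⁻¹, inv_pos.2 hZ, ?_⟩
  simp_rw [ENNReal.ofReal_mul (inv_pos.2 hZ).le, ENNReal.ofReal_inv_of_pos hZ,
    ENNReal.ofReal_toReal ht]
  rw [posterior, unnormPosterior_eq_withDensity hn]
  exact (withDensity_smul _ ((measurable_likelihoodOn N).mul hρm).ennreal_ofReal).symm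

lemma mul_unnormPosterior_compl_nbhd_le (hθs : θs ∈ Theta d) (hd : 0 < d) (hn : 0 < n)
    (hN : ∑ j, N j = n) (hs : 0 < s) (hsmall : s ^ 2 * (d / n) ≤ thetaMin θs / 25)
    (hhat : 4 * chiSq (fullPmf θs) (fullPmf (empirical n N) - fullPmf θs) ≤ s ^ 2 * (d / n))
    (hκ : 2 * tailBound d s ≤ 1) {m M : ℝ} (hm : 0 ≤ m) (hM : 0 ≤ M)
    (hρm : ∀ θ ∈ nbhd n θs s, m ≤ ρ θ) (hρM : ∀ θ ∈ Theta d, ρ θ ≤ M) :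
    ENNReal.ofReal m * unnormPosterior n ρ N (nbhd n θs s)ᶜ
      ≤ ENNReal.ofReal (2 * M * tailBound d s) * unnormPosterior n ρ N (nbhd n θs s) := by
  have hU := (isClosed_nbhd hθs hn hs.le).measurableSet
  rw [unnormPosterior_eq_withDensity hn, withDensity_apply _ hU, withDensity_apply _ hU.compl,
    ENNReal.ofReal_mul (by positivity), ENNReal.ofReal_mul zero_le_two, ENNReal.ofReal_ofNat]
  refine mul_setLIntegral_compl_le_of_comparable hU ?_ ENNReal.ofReal_ne_top ?_ ?_
    (lintegral_likelihoodOn_ne_top N)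
    (setLIntegral_likelihoodOn_compl_nbhd_le hθs hd hn hN hs hsmall hhat)
  · rw [← ENNReal.ofReal_ofNat, ← ENNReal.ofReal_inv_of_pos two_pos]
    exact ENNReal.ofReal_le_ofReal (by linarith)
  · intro θ _
    rw [← ENNReal.ofReal_mul hM, mul_comm M]
    refine ENNReal.ofReal_le_ofReal ?_
    by_cases hθ : θ ∈ Theta d
    · exact mul_le_mul_of_nonneg_left (hρM θ hθ) (likelihoodOn_nonneg N θ)
    · simp only [likelihoodOn_of_notMem hθ, zero_mul, le_refl]
  · intro θ hθ
    rw [← ENNReal.ofReal_mul hm, mul_comm m]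
    exact ENNReal.ofReal_le_ofReal
      (mul_le_mul_of_nonneg_left (hρm θ hθ) (likelihoodOn_nonneg N θ))

lemma posterior_compl_nbhd_le (hθs : θs ∈ Theta d) (hd : 0 < d) (hn : 0 < n)
    (hN : ∑ j, N j = n) (hs : 0 < s) (hsmall : s ^ 2 * (d / n) ≤ thetaMin θs / 25)
    (hhat : 4 * chiSq (fullPmf θs) (fullPmf (empirical n N) - fullPmf θs) ≤ s ^ 2 * (d / n))
    (hκ : 2 * tailBound d s ≤ 1) {m M : ℝ} (hm : 0 < m)
    (hρm : ∀ θ ∈ nbhd n θs s, m ≤ ρ θ) (hρM : ∀ θ ∈ Theta d, ρ θ ≤ M)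
    (h0 : unnormPosterior n ρ N Set.univ ≠ 0) (ht : unnormPosterior n ρ N Set.univ ≠ ⊤) :
    posterior n ρ N (nbhd n θs s)ᶜ ≤ ENNReal.ofReal (2 * M * tailBound d s / m) := by
  have hM : 0 ≤ M := hm.le.trans ((hρm θs (center_mem_nbhd hθs hn hs.le)).trans (hρM θs hθs))
  have hcomp := mul_unnormPosterior_compl_nbhd_le hθs hd hn hN hs hsmall hhat hκ hm.le hM hρm hρM
  rw [posterior, Measure.smul_apply, smul_eq_mul, mul_comm, ← div_eq_mul_inv,
    ENNReal.div_le_iff h0 ht, ENNReal.ofReal_div_of_pos hm, ← ENNReal.mul_div_right_comm,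
    ENNReal.le_div_iff_mul_le (.inl (by simpa)) (.inl ENNReal.ofReal_ne_top), mul_comm]
  exact hcomp.trans (by gcongr; exact Set.subset_univ _)

lemma likelihoodOn_mul_prior_pos (hθs : θs ∈ Theta d) (hn : 0 < n) (N : Fin (d + 1) → ℕ)
    (hs : 0 ≤ s) (hsmall : s ^ 2 * (d / n) ≤ thetaMin θs / 25)
    (hδ : delta01 n ρ θs s ≤ ENNReal.ofReal δ) {x : EuclideanSpace ℝ (Fin d)}
    (hx : x ∈ nbhd n θs s) : 0 < likelihoodOn N x * ρ x := by
  have hxΘ := mem_Theta_of_chiSq_le hθs (((mem_nbhd_iff hθs hn hs).1 hx).trans hsmall)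
  rw [likelihoodOn_of_mem hxΘ]
  exact mul_pos (likelihood_pos hxΘ N)
    (contDiffAt_and_pos_and_dualNorm_le_of_delta01_le hδ hx).2.1

lemma log_likelihoodOn_mul_prior_sub_le (hθs : θs ∈ Theta d) (hn : 0 < n) (hN : ∑ j, N j = n)
    (hs : 0 ≤ s) (hsmall : s ^ 2 * (d / n) ≤ thetaMin θs / 25)
    (hhat : chiSq (fullPmf θs) (fullPmf (empirical n N) - fullPmf θs) ≤ s ^ 2 * (d / n))
    (hδ0 : 0 ≤ δ) (hδ : delta01 n ρ θs s ≤ ENNReal.ofReal δ)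
    (hη : 4 * s ^ 2 * (d / √(n * thetaMin θs)) + δ / √n ≤ η)
    {x y : EuclideanSpace ℝ (Fin d)} (hx : x ∈ nbhd n θs s) (hy : y ∈ nbhd n θs s) :
    Real.log (likelihoodOn N x * ρ x)
        - n * chiSq (fullPmf θs) (fullPmf y - fullPmf (empirical n N))
      ≤ η ^ 2 + Real.log (likelihoodOn N y * ρ y)
        - n * chiSq (fullPmf θs) (fullPmf (midpoint ℝ x y) - fullPmf (empirical n N)) := by
  have hn' : (0 : ℝ) < n := by exact_mod_cast hn
  have hm := thetaMin_pos hθs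
  have hρx := (contDiffAt_and_pos_and_dualNorm_le_of_delta01_le hδ hx).2.1
  have hρy := (contDiffAt_and_pos_and_dualNorm_le_of_delta01_le hδ hy).2.1
  have hprior := log_prior_sub_le hθs hn hs hδ0 hδ hx hy
  rw [mem_nbhd_iff hθs hn hs] at hx hy
  have hxΘ := mem_Theta_of_chiSq_le hθs (hx.trans hsmall)
  have hyΘ := mem_Theta_of_chiSq_le hθs (hy.trans hsmall)
  have hlik := mul_le_mul_of_nonneg_left (logLik_add_chiSq_sub_le (h := fullPmf (empirical n N)) hm
    (thetaMin_le θs) hsmall (by rw [sum_fullPmf, sum_fullPmf]) hx hy hhat) hn'.le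
  rw [fullPmf_midpoint, chiSq_sub_midpoint, likelihoodOn_of_mem hxΘ, likelihoodOn_of_mem hyΘ,
    Real.log_mul (likelihood_pos hxΘ N).ne' hρx.ne',
    Real.log_mul (likelihood_pos hyΘ N).ne' hρy.ne',
    log_likelihood_eq_mul_logLik hn hN hxΘ, log_likelihood_eq_mul_logLik hn hN hyΘ]
  set q := √(chiSq (fullPmf θs) (fullPmf x - fullPmf y))
  have hq2 : q ^ 2 = chiSq (fullPmf θs) (fullPmf x - fullPmf y) :=
    Real.sq_sqrt (chiSq_nonneg (fun j => (mem_Theta_iff.1 hθs j).le) _)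
  have hlinear : n * (4 * (s ^ 2 * (d / n)) / √(thetaMin θs) * q) + δ * q ≤ η * (√n * q) := by
    refine le_of_eq_of_le ?_ (mul_le_mul_of_nonneg_right hη (by positivity))
    rw [Real.sqrt_mul hn'.le]
    field_simp
  have hquadratic : η * (√n * q) ≤ η ^ 2 + n * q ^ 2 / 4 := by
    nlinarith [sq_nonneg (η - √n * q / 2), Real.sq_sqrt hn'.le]
  rw [hq2] at hquadratic
  linarith

lemma posteriorDensity_mul_gaussianDensity_sq_le (hθs : θs ∈ Theta d) (hn : 0 < n)
    (hN : ∑ j, N j = n) (hs : 0 ≤ s) (hsmall : s ^ 2 * (d / n) ≤ thetaMin θs / 25)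
    (hhat : chiSq (fullPmf θs) (fullPmf (empirical n N) - fullPmf θs) ≤ s ^ 2 * (d / n))
    (hδ0 : 0 ≤ δ) (hδ : delta01 n ρ θs s ≤ ENNReal.ofReal δ)
    (hη : 4 * s ^ 2 * (d / √(n * thetaMin θs)) + δ / √n ≤ η) {k l : ℝ} (hk : 0 ≤ k)
    {x y : EuclideanSpace ℝ (Fin d)} (hx : x ∈ nbhd n θs s) (hy : y ∈ nbhd n θs s) :
    k * (likelihoodOn N x * ρ x) * (l * Real.exp
        (-(n * chiSq (fullPmf θs) (fullPmf y - fullPmf (empirical n N))) / 2)) ^ 2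
      ≤ Real.exp (η ^ 2) * (k * (likelihoodOn N y * ρ y)) * (l * Real.exp
        (-(n * chiSq (fullPmf θs)
          (fullPmf (midpoint ℝ x y) - fullPmf (empirical n N))) / 2)) ^ 2 := by
  have hlog := log_likelihoodOn_mul_prior_sub_le hθs hn hN hs hsmall hhat hδ0 hδ hη hx hy
  have hexp_log : ∀ {z}, z ∈ nbhd n θs s →
      likelihoodOn N z * ρ z = Real.exp (Real.log (likelihoodOn N z * ρ z)) := fun hz =>
    (Real.exp_log (likelihoodOn_mul_prior_pos hθs hn N hs hsmall hδ hz)).symm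
  have hsq : ∀ a : ℝ, (l * Real.exp (-a / 2)) ^ 2 = l ^ 2 * Real.exp (-a) := fun a => by
    rw [mul_pow, ← Real.exp_nat_mul, Nat.cast_ofNat, mul_div_cancel₀ _ two_ne_zero]
  rw [hexp_log hx, hexp_log hy, hsq, hsq]
  refine le_of_eq_of_le ?_ ((mul_le_mul_of_nonneg_left (Real.exp_le_exp.2 hlog)
    (mul_nonneg hk (sq_nonneg l))).trans_eq ?_)
  · rw [Real.exp_sub, Real.exp_neg]
    ring
  · rw [Real.exp_sub, Real.exp_add, Real.exp_neg]
    ring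

lemma one_le_exp_of_M0_le (hd : 0 < d) (hθs : θs ∈ Theta d) (hρs : 0 < ρ θs) {C : ℝ}
    (hC : M0 ρ θs ≤ (C : EReal)) : 1 ≤ Real.exp ((C + 1) * d) := by
  rw [add_one_mul, Real.exp_add]
  refine one_le_mul_of_one_le_of_one_le ?_ (Real.one_le_exp d.cast_nonneg)
  exact le_of_mul_le_mul_right (by simpa using prior_le_of_M0_le hd hρs hC hθs) hρs

lemma tvDist_posterior_gammaStar_le (hθs : θs ∈ Theta d) (hd : 0 < d) (hn : 0 < n)
    (hN : ∑ j, N j = n) (hs : 0 < s) (hsmall : s ^ 2 * (d / n) ≤ thetaMin θs / 25)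
    (hhat : 4 * chiSq (fullPmf θs) (fullPmf (empirical n N) - fullPmf θs) ≤ s ^ 2 * (d / n))
    (hρm : Measurable ρ) (hρ0 : ∀ θ, 0 ≤ ρ θ) (hρs : 0 < ρ θs) {C : ℝ}
    (hC : M0 ρ θs ≤ (C : EReal)) (hδ0 : 0 ≤ δ) (hδ : delta01 n ρ θs s ≤ ENNReal.ofReal δ)
    (hδs : δ * s ≤ √n) (hη : 4 * s ^ 2 * (d / √(n * thetaMin θs)) + δ / √n ≤ η)
    (hκ : 2 * Real.exp ((C + 1) * d) * tailBound d s ≤ κ) (hκ1 : κ < 1)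
    (h0 : unnormPosterior n ρ N Set.univ ≠ 0) (ht : unnormPosterior n ρ N Set.univ ≠ ⊤) :
    tvDist (posterior n ρ N) (gammaStar n θs (empirical n N))
      ≤ √(Real.exp (η ^ 2) / (1 - κ) - 1 + 2 * κ) + κ := by
  have := isProbabilityMeasure_posterior h0 ht
  have := isProbabilityMeasure_gammaStar n θs (empirical n N)
  have hchi0 := chiSq_nonneg (fun j => (mem_Theta_iff.1 hθs j).le)
    (fullPmf (empirical n N) - fullPmf θs)
  have hM : ∀ θ ∈ Theta d, ρ θ ≤ Real.exp (C * d) * ρ θs := fun θ hθ =>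
    prior_le_of_M0_le hd hρs hC hθ
  have htail0 : 0 ≤ tailBound d s := tailBound_nonneg d s
  have htail : 2 * tailBound d s ≤ κ := by nlinarith [one_le_exp_of_M0_le hd hθs hρs hC]
  obtain ⟨k, hk, hπ⟩ := exists_posterior_eq_withDensity hn hρm h0 ht
  obtain ⟨l, hl, hγ⟩ := exists_gammaStar_eq_withDensity hθs hn (empirical n N)
  have hw : Measurable fun θ => k * (likelihoodOn N θ * ρ θ) :=
    ((measurable_likelihoodOn N).mul hρm).const_mul k
  have hg : Measurable fun θ => l * Real.exp
      (-(n * chiSq (fullPmf θs) (fullPmf θ - fullPmf (empirical n N))) / 2) := by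
    have hcont := continuous_chiSq (fullPmf θs)
    have hpmf := continuous_fullPmf (d := d)
    fun_prop
  refine tvDist_le_sqrt_add hw
    (fun θ => mul_nonneg hk.le (mul_nonneg (likelihoodOn_nonneg N θ) (hρ0 θ))) hg
    (fun θ => by positivity) hπ hγ (isClosed_nbhd hθs hn hs.le).measurableSet
    (fun θ hθ => mul_pos hk (likelihoodOn_mul_prior_pos hθs hn N hs.le hsmall hδ hθ))
    (Real.exp_pos _).le
    (fun x hx y hy => posteriorDensity_mul_gaussianDensity_sq_le hθs hn hN hs.le hsmall
      (by linarith) hδ0 hδ hη hk.le hx hy) hκ1 ?_ ?_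
  · have hcompl := posterior_compl_nbhd_le hθs hd hn hN hs hsmall hhat (htail.trans hκ1.le)
      (mul_pos (Real.exp_pos _) hρs)
      (fun θ hθ => exp_neg_mul_prior_le hθs hd hn hs.le hδ0 hδ hδs hθ) hM h0 ht
    refine ENNReal.toReal_le_of_le_ofReal (by linarith)
      (hcompl.trans (ENNReal.ofReal_le_ofReal (le_of_eq_of_le ?_ hκ)))
    rw [add_one_mul, Real.exp_add, Real.exp_neg]
    field_simp
  · exact ENNReal.toReal_le_of_le_ofReal (by linarith)
      ((gammaStar_compl_nbhd_le hθs hn hs.le hhat).trans (ENNReal.ofReal_le_ofReal (by linarith)))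

end Posterior

section BernsteinVonMises

variable {d n : ℕ} {θs : EuclideanSpace ℝ (Fin d)} {N : Fin (d + 1) → ℕ}
  {ρ : EuclideanSpace ℝ (Fin d) → ℝ} {s τ η κ B C : ℝ}

/-- The event in the Bernstein–von Mises theorem: the posterior is well defined, the maximum
likelihood estimator exists and is unique, and the posterior is within `ε` of `gammaStar`. -/
def PosteriorNearGaussian (n : ℕ) (θs : EuclideanSpace ℝ (Fin d))
    (ρ : EuclideanSpace ℝ (Fin d) → ℝ) (N : Fin (d + 1) → ℕ) (ε : ℝ) : Prop :=
  IsProbabilityMeasure (posterior n ρ N) ∧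
    ∃ θh, IsUniqueMLE n N θh ∧ tvDist (posterior n ρ N) (gammaStar n θs θh) ≤ ε

lemma PosteriorNearGaussian.mono {ε ε' : ℝ} (h : PosteriorNearGaussian n θs ρ N ε)
    (hε : ε ≤ ε') : PosteriorNearGaussian n θs ρ N ε' :=
  ⟨h.1, h.2.imp fun _ hθh => ⟨hθh.1, hθh.2.trans hε⟩⟩

lemma two_mul_exp_mul_tailBound_le (hd : 0 < d) (hB : 0 ≤ B) (hs : 64 * (C + 2 + B) ≤ s ^ 2) :
    2 * Real.exp ((C + 1) * d) * tailBound d s ≤ 2 * Real.exp (-B) := by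
  have hd' : (1 : ℝ) ≤ d := by exact_mod_cast hd
  have htwo : (2 : ℝ) ^ d ≤ Real.exp d := by
    rw [← mul_one (d : ℝ), Real.exp_nat_mul]
    gcongr
    linarith [Real.add_one_le_exp 1]
  calc 2 * Real.exp ((C + 1) * d) * tailBound d s
      ≤ 2 * Real.exp ((C + 1) * d) * (Real.exp (-(s ^ 2 * d / 64)) * Real.exp d) := by
        unfold tailBound
        gcongr
    _ = 2 * Real.exp ((C + 2 - s ^ 2 / 64) * d) := by
        rw [mul_assoc, ← Real.exp_add, ← Real.exp_add]
        ring_nf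
    _ ≤ 2 * Real.exp (-B) := by
        gcongr
        nlinarith

lemma sqrt_div_sub_add_le {ε E : ℝ} (hε : 0 < ε) (hε1 : ε ≤ 1) (hE : E ≤ 1 + ε ^ 2 / 16) :
    √(E / (1 - ε ^ 2 / 16) - 1 + 2 * (ε ^ 2 / 16)) + ε ^ 2 / 16 ≤ ε := by
  have hε2 : ε ^ 2 ≤ 1 := pow_le_one₀ hε.le hε1
  have hE' : E / (1 - ε ^ 2 / 16) ≤ 1 + 3 * ε ^ 2 / 16 := by
    rw [div_le_iff₀ (by nlinarith)]
    nlinarith [mul_nonneg (sq_nonneg ε) (sub_nonneg.2 hε2)]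
  have hsqrt : √(E / (1 - ε ^ 2 / 16) - 1 + 2 * (ε ^ 2 / 16)) ≤ 3 / 4 * ε :=
    Real.sqrt_le_iff.2 ⟨by positivity, by nlinarith⟩
  nlinarith

lemma sq_mul_div_le_thetaMin_div (hd : 0 < d) (hn : 0 < n) (hθs : θs ∈ Theta d) (hs : 0 < s)
    (hτ : 0 ≤ τ) (hτs : τ * (5 * s) ≤ 1) (hdim : (d : ℝ) ^ 2 / (n * thetaMin θs) ≤ τ ^ 2) :
    s ^ 2 * (d / n) ≤ thetaMin θs / 25 := by
  have hn' : (0 : ℝ) < n := by exact_mod_cast hn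
  have hd' : (1 : ℝ) ≤ d := by exact_mod_cast hd
  have hm := thetaMin_pos hθs
  have hd2 : (d : ℝ) ^ 2 * (5 * s) ^ 2 ≤ n * thetaMin θs := by
    rw [div_le_iff₀ (by positivity)] at hdim
    calc (d : ℝ) ^ 2 * (5 * s) ^ 2 ≤ τ ^ 2 * (n * thetaMin θs) * (5 * s) ^ 2 := by gcongr
      _ = (τ * (5 * s)) ^ 2 * (n * thetaMin θs) := by ring
      _ ≤ n * thetaMin θs :=
        mul_le_of_le_one_left (by positivity) (pow_le_one₀ (by positivity) hτs)
  rw [← mul_div_assoc, div_le_div_iff₀ hn' (by norm_num)]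
  calc s ^ 2 * d * 25 ≤ s ^ 2 * d * 25 * d := le_mul_of_one_le_right (by positivity) hd'
    _ = d ^ 2 * (5 * s) ^ 2 := by ring
    _ ≤ thetaMin θs * n := by linarith

lemma posteriorNearGaussian_of_le (hd : 0 < d) (hn : 0 < n) (hθs : θs ∈ Theta d)
    (hρm : Measurable ρ) (hρ0 : ∀ θ, 0 ≤ ρ θ) (hρs : 0 < ρ θs) (hC : M0 ρ θs ≤ (C : EReal))
    (hs : 0 < s) (hτ : 0 ≤ τ) (hτs : τ * (5 * s) ≤ 1) (hη : τ * (4 * s ^ 2 + 1) ≤ η)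
    (hdim : (d : ℝ) ^ 2 / (n * thetaMin θs) ≤ τ ^ 2)
    (hδ : delta01 n ρ θs s ≤ ENNReal.ofReal (τ * √n))
    (hκ : 2 * Real.exp ((C + 1) * d) * tailBound d s ≤ κ) (hκ1 : κ < 1) (hN : ∑ j, N j = n)
    (hhat : 4 * chiSq (fullPmf θs) (fullPmf (empirical n N) - fullPmf θs) ≤ s ^ 2 * (d / n)) :
    PosteriorNearGaussian n θs ρ N (√(Real.exp (η ^ 2) / (1 - κ) - 1 + 2 * κ) + κ) := by
  have hn' : (0 : ℝ) < n := by exact_mod_cast hn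
  have hm := thetaMin_pos hθs
  have hsmall := sq_mul_div_le_thetaMin_div hd hn hθs hs hτ hτs hdim
  have hdim_sqrt : d / √(n * thetaMin θs) ≤ τ := by
    refine (abs_le_of_sq_le_sq' ?_ hτ).2
    rwa [div_pow, Real.sq_sqrt (by positivity)]
  have hη' : 4 * s ^ 2 * (d / √(n * thetaMin θs)) + τ * √n / √n ≤ η := by
    rw [mul_div_cancel_right₀ _ (Real.sqrt_pos.2 hn').ne']
    nlinarith [mul_le_mul_of_nonneg_left hdim_sqrt (by positivity : 0 ≤ 4 * s ^ 2)]
  have hδs : τ * √n * s ≤ √n := by nlinarith [Real.sqrt_nonneg (n : ℝ)]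
  have hρc := (contDiffAt_and_pos_and_dualNorm_le_of_delta01_le hδ
    (center_mem_nbhd hθs hn hs.le)).1.continuousAt
  have h0 := unnormPosterior_univ_ne_zero hθs hn N hρm hρc hρs
  have ht := unnormPosterior_univ_ne_top hn N hρ0 fun θ hθ => prior_le_of_M0_le hd hρs hC hθ
  exact ⟨isProbabilityMeasure_posterior h0 ht, empirical n N,
    isUniqueMLE_empirical hn hN (empirical_mem_Theta hθs hsmall hhat),
    tvDist_posterior_gammaStar_le hθs hd hn hN hs hsmall hhat hρm hρ0 hρs hC (by positivity) hδ
      hδs hη' hκ hκ1 h0 ht⟩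

theorem exists_forall_posteriorNearGaussian (C K : ℝ) {ε : ℝ} (hε : 0 < ε) :
    ∃ s > 0, ∃ τ > 0, ∀ {d n : ℕ} {θs : EuclideanSpace ℝ (Fin d)}
      {ρ : EuclideanSpace ℝ (Fin d) → ℝ} {N : Fin (d + 1) → ℕ}, 0 < d → 0 < n → θs ∈ Theta d →
      Measurable ρ → (∀ θ, 0 ≤ ρ θ) → 0 < ρ θs → M0 ρ θs ≤ (C : EReal) →
      (d : ℝ) ^ 2 / (n * thetaMin θs) ≤ τ ^ 2 →
      delta01 n ρ θs s ≤ ENNReal.ofReal (τ * √n) → ∑ j, N j = n →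
      chiSq (fullPmf θs) (fullPmf (empirical n N) - fullPmf θs) ≤ K ^ 2 * (d / n) →
      PosteriorNearGaussian n θs ρ N ε := by
  wlog hε1 : ε ≤ 1 generalizing ε
  · obtain ⟨s, hs, τ, hτ, h⟩ := this one_pos le_rfl
    exact ⟨s, hs, τ, hτ, fun hd hn hθs hρm hρ0 hρs hC hdim hδ hN hhat =>
      (h hd hn hθs hρm hρ0 hρs hC hdim hδ hN hhat).mono (not_le.1 hε1).le⟩
  set κ := ε ^ 2 / 16 with hκ
  have hκ0 : 0 < κ := by positivity
  have hκ1 : κ < 1 := by nlinarith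
  have hB : 0 < Real.log (2 / κ) := Real.log_pos (by rw [one_lt_div hκ0]; linarith)
  have hlog : 0 < Real.log (1 + κ) := Real.log_pos (by linarith)
  set s := √(64 * (|C| + 2 + Real.log (2 / κ)) + 4 * K ^ 2)
  have hs2 : s ^ 2 = 64 * (|C| + 2 + Real.log (2 / κ)) + 4 * K ^ 2 := Real.sq_sqrt (by positivity)
  have hs : 0 < s := by positivity
  refine ⟨s, hs, min (1 / (5 * s)) (√(Real.log (1 + κ)) / (4 * s ^ 2 + 1)), by positivity, ?_⟩
  intro d n θs ρ N hd hn hθs hρm hρ0 hρs hC hdim hδ hN hhat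
  refine (posteriorNearGaussian_of_le (η := √(Real.log (1 + κ))) hd hn hθs hρm hρ0 hρs hC hs
    (by positivity) ?_ ?_ hdim hδ ?_ hκ1 hN ?_).mono (sqrt_div_sub_add_le hε hε1 ?_)
  · rw [← le_div_iff₀ (by positivity)]
    exact min_le_left _ _
  · rw [← le_div_iff₀ (by positivity)]
    exact min_le_right _ _
  · refine (two_mul_exp_mul_tailBound_le hd hB.le ?_).trans_eq ?_
    · nlinarith [le_abs_self C]
    · rw [Real.exp_neg, Real.exp_log (by positivity)]
      field_simp
  · refine (mul_le_mul_of_nonneg_left hhat zero_le_four).trans ?_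
    rw [← mul_assoc]
    gcongr
    nlinarith [abs_nonneg C]
  · rw [Real.sq_sqrt hlog.le, Real.exp_log (by linarith)]

lemma exists_lt_one_sub_ofReal_one_div_sq {a : ℝ≥0∞} (ha : a < 1) :
    ∃ K : ℝ, 0 < K ∧ a < 1 - ENNReal.ofReal (1 / K ^ 2) := by
  have hlim : Tendsto (fun K : ℝ => 1 - ENNReal.ofReal (1 / K ^ 2)) atTop (𝓝 1) := by
    have hsq : Tendsto (fun K : ℝ => 1 / K ^ 2) atTop (𝓝 0) :=
      tendsto_const_nhds.div_atTop (tendsto_pow_atTop two_ne_zero)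
    simpa using ENNReal.Tendsto.sub tendsto_const_nhds (ENNReal.tendsto_ofReal hsq)
      (.inl ENNReal.one_ne_top)
  exact ((eventually_gt_atTop 0).and (hlim.eventually_const_lt ha)).exists

lemma isProbabilityMeasure_multinomial (n : ℕ) (hθs : θs ∈ Theta d) :
    IsProbabilityMeasure (multinomial n θs) := by
  have := isProbabilityMeasure_categorical hθs
  exact Measure.isProbabilityMeasure_map Measurable.of_discrete.aemeasurable

end BernsteinVonMises

end PmfBvM

open PmfBvM in
theorem corollary5p6
    (d : ℕ → ℕ) (hd : ∀ n, 1 ≤ d n)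
    (θs : ∀ n, EuclideanSpace ℝ (Fin (d n))) (hθs : ∀ n, θs n ∈ PmfBvM.Theta (d n))
    (ρ : ∀ n, EuclideanSpace ℝ (Fin (d n)) → ℝ)
    (hρ_meas : ∀ n, Measurable (ρ n)) (hρ_nonneg : ∀ n θ, 0 ≤ ρ n θ)
    (hρ_pos : ∀ n, 0 < ρ n (θs n))
    (hM0 : ∃ C : ℝ, ∀ᶠ n in atTop, PmfBvM.M0 (ρ n) (θs n) ≤ (C : EReal))
    (hdelta : ∀ s : ℝ, 0 ≤ s →
      Tendsto (fun n : ℕ => PmfBvM.delta01 n (ρ n) (θs n) s / ENNReal.ofReal (√(n : ℝ)))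
        atTop (𝓝 0))
    (hdim : Tendsto (fun n : ℕ => (d n : ℝ) ^ 2 / (n * PmfBvM.thetaMin (θs n))) atTop (𝓝 0)) :
    ∀ ε : ℝ, 0 < ε →
      Tendsto
        (fun n : ℕ => PmfBvM.multinomial n (θs n)
          {N | IsProbabilityMeasure (PmfBvM.posterior n (ρ n) N) ∧
            ∃ θh, PmfBvM.IsUniqueMLE n N θh ∧
              PmfBvM.tvDist (PmfBvM.posterior n (ρ n) N)
                (PmfBvM.gammaStar n (θs n) θh) ≤ ε})
        atTop (𝓝 1) := by
  intro ε hε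
  have hprob : ∀ n, IsProbabilityMeasure (multinomial n (θs n)) := fun n =>
    isProbabilityMeasure_multinomial n (hθs n)
  refine tendsto_order.2 ⟨fun a ha => ?_, fun b hb => .of_forall fun n => prob_le_one.trans_lt hb⟩
  obtain ⟨K, hK, hKa⟩ := exists_lt_one_sub_ofReal_one_div_sq ha
  obtain ⟨C, hC⟩ := hM0
  obtain ⟨s, hs, τ, hτ, hnear⟩ := exists_forall_posteriorNearGaussian C K hε
  filter_upwards [hC, hdim.eventually_le_const (pow_pos hτ 2),
    (hdelta s hs.le).eventually_le_const (ENNReal.ofReal_pos.2 hτ), eventually_gt_atTop 0]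
    with n hCn hdimn hδn hn
  rw [ENNReal.div_le_iff_le_mul (.inl (by simpa using hn)) (.inl ENNReal.ofReal_ne_top),
    ← ENNReal.ofReal_mul hτ.le] at hδn
  exact hKa.trans_le ((one_sub_le_multinomial (hθs n) (hd n) hn hK).trans (measure_mono
    fun N hN => hnear (hd n) hn (hθs n) (hρ_meas n) (hρ_nonneg n) (hρ_pos n) hCn hdimn hδn
      hN.1 hN.2))
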